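/- Let $\mathbb{D}\subset\mathbb{R}^2$ be the unit disc and let $L^2_{rad}(\mathbb{D})$ be the space of complex-valued radial $L^2$ functions on $\mathbb{D}$. Let $0<z_1<z_2<\dots$ be the positive zeros of the Bessel function $J_0$ and let $e_n(x)=J_0(z_n|x|)/\|J_0(z_n|\cdot|)\|_{L^2(\mathbb{D})}$, $n\ge 1$, be the $L^2$-normalized radial Dirichlet eigenfunctions of $-\Delta$ on $\mathbb{D}$, with eigenvalues $z_n^2$. Let $P_{\le N}$ be the $L^2$-orthogonal projection of $L^2_{rad}(\mathbb{D})$ onto the complex span of $e_1,\dots,e_N$. Let $\mu$ be the free Gaussian measure on $L^2_{rad}(\mathbb{D})$, that is, the law of $$u=\sum_{n\ge1}\frac{g_n}{z_n}e_n ,$$ where the $g_n$ are independent complex Gaussian variables whose real and imaginary parts are independent with law $\mathcal{N}(0,v)$; here $v$ is either of the two usual normalizations, $v=\tfrac12$ or $v=1$. Let $Q$ be the ground state on $\mathbb{R}^2$, i.e. the positive, radial, exponentially decaying $C^2$ solution of $-\Delta Q+Q-Q^3=0$. For $\gamma>0$ let $S_\gamma$ be the set of all $u\in L^2_{rad}(\mathbb{D})$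 such that $\|u\|_{L^2(\mathbb{D})}\le\|Q\|_{L^2(\mathbb{R}^2)}$ and $$\frac14\int_{\mathbb{D}}|P_{\le N}u|^4\,dx\le\frac{1-\gamma}{2}\int_{\mathbb{D}}|\nabla P_{\le N}u|^2\,dx\qquad\text{for every dyadic } N=2^k,\ k=0,1,2,\dots$$ **Proposition.** For every $\gamma>0$ (and for both $v=\tfrac12$ and $v=1$), $$\mathbb{E}_\mu\Big[e^{\frac14\int_{\mathbb{D}}|u|^4\,dx},\,S_\gamma\Big]:=\int_{S_\gamma}e^{\frac14\int_{\mathbb{D}}|u|^4\,dx}\,d\mu(u)<\infty .$$ -/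

import Mathlib

open MeasureTheory ProbabilityTheory Filter Topology
open scoped ENNReal NNReal

noncomputable section

namespace DiscGibbs

/-- The Euclidean plane `ℝ²`. -/
abbrev Plane : Type := EuclideanSpace ℝ (Fin 2)

/-- The open unit disc `𝔻 ⊆ ℝ²`. -/
def disc : Set Plane := Metric.ball 0 1

/-- Lebesgue measure on the unit disc. -/
def discMeasure : Measure Plane := volume.restrict disc

instance : IsFiniteMeasure discMeasure :=
  ⟨by simp [discMeasure, disc]⟩

/-! ### The ground state -/

/-- `Q` is the ground state on `ℝ²`: a positive, radial, exponentially decaying classical solution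
of `-ΔQ + Q - Q³ = 0`. (There is exactly one such function.) -/
structure IsGroundState (Q : Plane → ℝ) : Prop where
  contDiff : ContDiff ℝ 2 Q
  pos : ∀ x, 0 < Q x
  radial : ∃ q : ℝ → ℝ, ∀ x, Q x = q ‖x‖
  decay : ∃ C c : ℝ, 0 < c ∧ ∀ x, |Q x| ≤ C * Real.exp (-c * ‖x‖)
  equation : ∀ x, -(Laplacian.laplacian Q x) + Q x - Q x ^ 3 = 0

/-! ### The Bessel function of order zero and its zeros -/

/-- The Bessel function `J₀(r) = ∑ₘ (-1)ᵐ / (m!)² (r/2)²ᵐ`. -/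
def besselJ0 (r : ℝ) : ℝ :=
  ∑' m : ℕ, (-1 : ℝ) ^ m / (m.factorial : ℝ) ^ 2 * (r / 2) ^ (2 * m)

/-- The positive zeros of `J₀` in increasing order. The index starts at `0`:
`besselZero n` is the `(n+1)`-st positive zero. -/
def besselZero : ℕ → ℝ
  | 0 => sInf {r : ℝ | 0 < r ∧ besselJ0 r = 0}
  | n + 1 => sInf {r : ℝ | besselZero n < r ∧ besselJ0 r = 0}

theorem continuous_besselJ0 : Continuous besselJ0 := by
  refine continuous_iff_continuousAt.2 fun r => ?_
  have hbound : ∀ (m : ℕ) (x : ℝ), x ∈ Metric.ball (0 : ℝ) (|r| + 1) →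
      ‖(-1 : ℝ) ^ m / (m.factorial : ℝ) ^ 2 * (x / 2) ^ (2 * m)‖ ≤
        (((|r| + 1) / 2) ^ 2) ^ m / (m.factorial : ℝ) := by
    intro m x hx
    have hx' : |x| ≤ |r| + 1 := by
      simpa [Real.norm_eq_abs] using (mem_ball_zero_iff.1 hx).le
    have hf : (1 : ℝ) ≤ m.factorial := by
      exact_mod_cast Nat.one_le_iff_ne_zero.2 m.factorial_ne_zero
    have h1 : ‖(-1 : ℝ) ^ m / (m.factorial : ℝ) ^ 2 * (x / 2) ^ (2 * m)‖ =
        ((|x| / 2) ^ 2) ^ m / (m.factorial : ℝ) ^ 2 := by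
      rw [norm_mul, norm_div, norm_pow, norm_pow, norm_pow, norm_neg, norm_one, one_pow, pow_mul,
        norm_div, Real.norm_eq_abs x, Real.norm_of_nonneg (Nat.cast_nonneg m.factorial),
        Real.norm_of_nonneg (by norm_num : (0 : ℝ) ≤ 2), div_mul_eq_mul_div, one_mul]
    have h2 : (m.factorial : ℝ) ≤ (m.factorial : ℝ) ^ 2 := le_self_pow₀ hf two_ne_zero
    rw [h1]
    gcongr
  have key : ContinuousOn besselJ0 (Metric.ball 0 (|r| + 1)) :=
    continuousOn_tsum (fun m => by fun_prop) (Real.summable_pow_div_factorial _) hbound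
  exact key.continuousAt (Metric.isOpen_ball.mem_nhds (by simp [Real.norm_eq_abs]))

/-! ### Radial square integrable functions on the disc -/

/-- `L²_rad(𝔻)`: the complex-valued `L²` functions on the disc that are (a.e. equal to) a function
of `|x|`. -/
def radialL2 : Submodule ℂ (Lp ℂ 2 discMeasure) where
  carrier := {u | ∃ φ : ℝ → ℂ, ∀ᵐ x ∂discMeasure, u x = φ ‖x‖}
  zero_mem' := ⟨0, by
    filter_upwards [Lp.coeFn_zero ℂ 2 discMeasure] with x hx
    simpa using hx⟩
  add_mem' := by
    rintro u w ⟨φ, hφ⟩ ⟨ψ, hψ⟩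
    refine ⟨φ + ψ, ?_⟩
    filter_upwards [hφ, hψ, Lp.coeFn_add u w] with x h1 h2 h3
    exact h3.trans (by simp [h1, h2])
  smul_mem' := by
    rintro c u ⟨φ, hφ⟩
    refine ⟨c • φ, ?_⟩
    filter_upwards [hφ, Lp.coeFn_smul c u] with x h1 h2
    exact h2.trans (by simp [h1])

theorem isClosed_radialL2 : IsClosed (radialL2 : Set (Lp ℂ 2 discMeasure)) := by
  refine IsSeqClosed.isClosed ?_
  intro u w hu hw
  choose φ hφ using hu
  obtain ⟨ns, -, hns⟩ := (tendstoInMeasure_of_tendsto_Lp hw).exists_seq_tendsto_ae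
  refine ⟨fun r => limUnder atTop fun k => φ (ns k) r, ?_⟩
  filter_upwards [hns, ae_all_iff.2 hφ] with x h1 h2
  simp only [h2] at h1
  exact h1.limUnder_eq.symm

/-- The space `L²_rad(𝔻)` as a type, with its Borel σ-algebra. -/
abbrev L2Rad : Type := radialL2

instance : CompleteSpace L2Rad := isClosed_radialL2.completeSpace_coe

instance : MeasurableSpace L2Rad := borel L2Rad

instance : BorelSpace L2Rad := ⟨rfl⟩

instance : SecondCountableTopology (Lp ℂ 2 discMeasure) :=
  haveI : Fact ((2 : ℝ≥0∞) ≠ ∞) := ⟨by simp⟩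
  haveI : IsSeparable discMeasure := by unfold discMeasure; infer_instance
  inferInstance

/-! ### The radial Dirichlet eigenfunctions -/

/-- The function `x ↦ J₀(zₙ|x|) / ‖J₀(zₙ|·|)‖_{L²(𝔻)}`. -/
def eigenFun (n : ℕ) (x : Plane) : ℂ :=
  ((besselJ0 (besselZero n * ‖x‖) /
    √(∫ y in disc, besselJ0 (besselZero n * ‖y‖) ^ 2) : ℝ) : ℂ)

theorem continuous_eigenFun (n : ℕ) : Continuous (eigenFun n) := by
  have := continuous_besselJ0
  unfold eigenFun
  fun_prop

theorem memLp_eigenFun (n : ℕ) : MemLp (eigenFun n) 2 discMeasure := by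
  obtain ⟨C, hC⟩ := (isCompact_closedBall (0 : Plane) 1).exists_bound_of_continuousOn
    (continuous_eigenFun n).continuousOn
  refine MemLp.of_bound (continuous_eigenFun n).aestronglyMeasurable C ?_
  exact (ae_restrict_mem Metric.isOpen_ball.measurableSet).mono
    fun x hx => hC x (Metric.ball_subset_closedBall hx)

/-- The eigenfunction `eₙ` as an element of `L²_rad(𝔻)` (with the index starting at `0`). -/
def eigenVec (n : ℕ) : L2Rad :=
  ⟨(memLp_eigenFun n).toLp (eigenFun n),
    fun r => ((besselJ0 (besselZero n * r) /
      √(∫ y in disc, besselJ0 (besselZero n * ‖y‖) ^ 2) : ℝ) : ℂ),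
    (memLp_eigenFun n).coeFn_toLp⟩

/-! ### The free Gaussian measure -/

/-- The law of a complex Gaussian whose real and imaginary parts are independent with
law `𝒩(0, v)`. -/
def complexGaussian (v : ℝ≥0) : Measure ℂ :=
  ((gaussianReal 0 v).prod (gaussianReal 0 v)).map Complex.measurableEquivRealProd.symm

instance (v : ℝ≥0) : IsProbabilityMeasure (complexGaussian v) :=
  Measure.isProbabilityMeasure_map (by fun_prop)

/-- The law of a sequence `(gₙ)` of independent complex Gaussians. -/
def gaussianSeq (v : ℝ≥0) : Measure (ℕ → ℂ) :=
  Measure.infinitePi fun _ => complexGaussian v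

/-- The random series `u = ∑ₙ (gₙ / zₙ) eₙ`, i.e. the limit in `L²_rad(𝔻)` of its partial sums
(which exists for almost every `g`). -/
def randomSeries (g : ℕ → ℂ) : L2Rad :=
  limUnder atTop fun N : ℕ => ∑ n ∈ Finset.range N, (g n / (besselZero n : ℂ)) • eigenVec n

/-- The free Gaussian measure `μ` on `L²_rad(𝔻)`: the law of `u = ∑ₙ (gₙ / zₙ) eₙ`. -/
def freeGaussian (v : ℝ≥0) : Measure L2Rad :=
  (gaussianSeq v).map randomSeries

theorem measurable_randomSeries : Measurable randomSeries := by
  refine StronglyMeasurable.measurable (StronglyMeasurable.limUnder fun N => ?_)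
  refine Measurable.stronglyMeasurable ?_
  refine Finset.measurable_fun_sum _ fun n _ => ?_
  exact Measurable.smul_const ((measurable_pi_apply n).div_const _) _

instance (v : ℝ≥0) : IsProbabilityMeasure (freeGaussian v) := by
  have : IsProbabilityMeasure (gaussianSeq v) := by unfold gaussianSeq; infer_instance
  exact Measure.isProbabilityMeasure_map measurable_randomSeries.aemeasurable

/-! ### Projections and the set `S_γ` -/

/-- The smooth representative `∑_{n < N} ⟨eₙ, u⟩ eₙ(x)` of `P_{≤N} u`, the orthogonal projection of
`u` on the span of the first `N` eigenfunctions. -/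
def projLE (N : ℕ) (u : L2Rad) (x : Plane) : ℂ :=
  ∑ n ∈ Finset.range N, inner ℂ (eigenVec n) u * eigenFun n x

/-- `|∇f(x)|² = |∂₁f(x)|² + |∂₂f(x)|²` for a complex-valued function on the plane. -/
def gradSq (f : Plane → ℂ) (x : Plane) : ℝ :=
  ∑ i : Fin 2, ‖fderiv ℝ f x (EuclideanSpace.single i 1)‖ ^ 2

/-- The set `S_γ` of all `u ∈ L²_rad(𝔻)` with `‖u‖_{L²(𝔻)} ≤ ‖Q‖_{L²(ℝ²)}` and
`¼ ∫_𝔻 |P_{≤N} u|⁴ ≤ (1 - γ)/2 ∫_𝔻 |∇P_{≤N} u|²` for every dyadic `N = 2ᵏ`. -/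
def awaySet (Q : Plane → ℝ) (γ : ℝ) : Set L2Rad :=
  {u | eLpNorm (u : Lp ℂ 2 discMeasure) 2 discMeasure ≤ eLpNorm Q 2 volume ∧ ∀ k : ℕ,
    1 / 4 * ∫ x in disc, ‖projLE (2 ^ k) u x‖ ^ 4 ≤
      (1 - γ) / 2 * ∫ x in disc, gradSq (projLE (2 ^ k) u) x}

/-- The weight `exp(¼ ∫_𝔻 |u|⁴)`, with value `∞` if the integral diverges. -/
def weight (u : L2Rad) : ℝ≥0∞ :=
  EReal.exp ((1 / 4 * ∫⁻ x in disc, ‖(u : Lp ℂ 2 discMeasure) x‖ₑ ^ 4 : ℝ≥0∞) : EReal)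

end DiscGibbs

end

noncomputable section

namespace DiscGibbs

/-! ### Bessel functions -/

/-! Cut the random series at a dyadic frequency N = 2^k. By orthogonality the kinetic energy of
P_{≤N} u is the sum of |g_n|² over n < N, so the constraint defining the set bounds the quartic
energy of P_{≤N} u by (1-γ)/2 times that sum. A complex Gaussian has finite exp(θ|g|²)-moment for θ
< 1/(2v), and v ≤ 1 gives 1/2 ≤ 1/(2v), so the factor 1-γ leaves strict room. Some of this room pays
for splitting u into P_{≤N} u and a tail (`add_pow_four_le`). The tail then costs only exp(cN),
provided the fourth power of its L⁴ norm is at most N (`weight_randomSeries_le`).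

Take for k the first index whose tail is small in this sense. Unless k = 0, the tail beyond N =
2^(k-1) is large, an event of probability at most 4(D N^(-1/4))^N
(`exists_gaussianSeq_largeTail_le`), which is smaller than every exponential exp(-KN). The
exponential moments in play grow only like exp(O(N)), so the contribution of each k is summable
(`exists_lintegral_largeTail_le`, `lintegral_kineticSet_lt_top`).

The tail bound rests on radial decay: e_n(r)² is at most a constant times z_n^(1/4) r^(-3/4), so the
tail at radius r is Gaussian of variance O(N^(-5/8) r^(-3/4)). The square of r^(-3/4) is integrable
on the disc, hence the N-th moment of the quartic norm is at most 4(D N² N^(-5/4))^N up to the value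
of D, and Markov's inequality against N^N gives the claim.

The facts needed on J₀ (decay, a lower bound for z J₁(z)² at the zeros z, linear growth of the
zeros) come from a nearly conserved energy of √r J₀(r). -/

/-- The entire function `∑ₘ (-s)ᵐ / (m! (m + j)!)`. -/
def besselSeries (j : ℕ) (s : ℝ) : ℝ :=
  ∑' m : ℕ, (-1 : ℝ) ^ m / (m.factorial * (m + j).factorial : ℝ) * s ^ m

theorem norm_besselSeries_coeff_le (j m : ℕ) :
    ‖(-1 : ℝ) ^ m / (m.factorial * (m + j).factorial : ℝ)‖ ≤ 1 / (m.factorial : ℝ) := by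
  rw [norm_div, norm_pow, norm_neg, norm_one, one_pow, Real.norm_of_nonneg (by positivity)]
  apply one_div_le_one_div_of_le (by positivity)
  exact le_mul_of_one_le_right (by positivity)
    (by exact_mod_cast Nat.one_le_iff_ne_zero.2 (m + j).factorial_ne_zero)

theorem summable_besselSeries (j : ℕ) (s : ℝ) :
    Summable fun m : ℕ => (-1 : ℝ) ^ m / (m.factorial * (m + j).factorial : ℝ) * s ^ m := by
  refine Summable.of_norm_bounded (Real.summable_pow_div_factorial |s|) fun m => ?_
  rw [norm_mul, norm_pow, Real.norm_eq_abs s, div_eq_mul_one_div (|s| ^ m), mul_comm]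
  gcongr
  exact norm_besselSeries_coeff_le j m

theorem hasDerivAt_besselSeries (j : ℕ) (s : ℝ) :
    HasDerivAt (besselSeries j) (-besselSeries (j + 1) s) s := by
  set c : ℕ → ℝ := fun m => (-1 : ℝ) ^ m / (m.factorial * (m + j).factorial : ℝ) with hc
  have hbound : ∀ (m : ℕ) (x : ℝ), x ∈ Metric.ball (0 : ℝ) (|s| + 1) →
      ‖c m * (m * x ^ (m - 1))‖ ≤ (2 * (|s| + 1)) ^ m / (m.factorial : ℝ) := by
    intro m x hx
    have hx' : |x| ≤ |s| + 1 := by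
      simpa [Real.norm_eq_abs] using (mem_ball_zero_iff.1 hx).le
    have h1 : (1 : ℝ) ≤ |s| + 1 := by linarith [abs_nonneg s]
    -- The factor m produced by differentiation is absorbed into a geometric one, so the majorant is
    -- again an exponential series.
    have h2 : (m : ℝ) ≤ 2 ^ m := by exact_mod_cast m.lt_two_pow_self.le
    rw [norm_mul, norm_mul, norm_pow, Real.norm_eq_abs x, Real.norm_of_nonneg (Nat.cast_nonneg m),
      div_eq_mul_one_div, mul_comm, mul_pow]
    gcongr
    · exact (pow_le_pow_left₀ (abs_nonneg x) hx' _).trans (pow_le_pow_right₀ h1 (Nat.sub_le m 1))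
    · exact norm_besselSeries_coeff_le j m
  have hs : s ∈ Metric.ball (0 : ℝ) (|s| + 1) := by simp [Real.norm_eq_abs]
  have key : HasDerivAt (besselSeries j) (∑' m : ℕ, c m * (m * s ^ (m - 1))) s :=
    hasDerivAt_tsum_of_isPreconnected (t := Metric.ball (0 : ℝ) (|s| + 1))
      (Real.summable_pow_div_factorial (2 * (|s| + 1))) Metric.isOpen_ball
      (convex_ball _ _).isPreconnected (fun m x _ => (hasDerivAt_pow m x).const_mul (c m))
      hbound hs (summable_besselSeries j s) hs
  refine key.congr_deriv ?_
  rw [Summable.tsum_eq_zero_add (Summable.of_norm_bounded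
    (Real.summable_pow_div_factorial (2 * (|s| + 1))) fun m => hbound m s hs), besselSeries,
    ← tsum_neg]
  simp only [Nat.cast_zero, zero_mul, mul_zero, zero_add]
  refine tsum_congr fun m => ?_
  have h1 := m.factorial_ne_zero
  have h2 := (m + 1 + j).factorial_ne_zero
  simp only [hc, Nat.factorial_succ, add_tsub_cancel_right, show m + (j + 1) = m + 1 + j by ring]
  push_cast
  field_simp
  ring

/-- This is Bessel's equation sF'' + F' + F = 0 for F = `besselSeries 0`, since each derivative
raises the index and changes the sign. -/
theorem besselSeries_recurrence (s : ℝ) :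
    s * besselSeries 2 s = besselSeries 1 s - besselSeries 0 s := by
  unfold besselSeries
  rw [← Summable.tsum_sub (summable_besselSeries 1 s) (summable_besselSeries 0 s),
    Summable.tsum_eq_zero_add ((summable_besselSeries 1 s).sub (summable_besselSeries 0 s)),
    ← tsum_mul_left]
  simp only [Nat.factorial_zero, pow_zero, Nat.cast_one, zero_add, Nat.factorial_one, mul_one,
    sub_self]
  refine tsum_congr fun m => ?_
  have h1 := m.factorial_ne_zero
  simp only [add_zero, Nat.factorial_succ]
  push_cast
  field_simp
  ring

theorem besselJ0_eq (r : ℝ) : besselJ0 r = besselSeries 0 ((r / 2) ^ 2) := by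
  simp only [besselJ0, besselSeries, add_zero, pow_mul, sq (Nat.cast _)]

/-- The Bessel function of order one, `J₁ = -J₀'`. -/
def besselJ1 (r : ℝ) : ℝ := r / 2 * besselSeries 1 ((r / 2) ^ 2)

theorem hasDerivAt_besselJ0 (r : ℝ) : HasDerivAt besselJ0 (-besselJ1 r) r := by
  have h : HasDerivAt (fun r : ℝ => (r / 2) ^ 2) (r / 2) r := by
    refine (((hasDerivAt_id r).div_const 2).pow 2).congr_deriv ?_
    simp only [id]
    ring
  have := (hasDerivAt_besselSeries 0 ((r / 2) ^ 2)).comp r h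
  rw [show besselJ0 = besselSeries 0 ∘ fun r => (r / 2) ^ 2 from funext besselJ0_eq]
  refine this.congr_deriv ?_
  unfold besselJ1
  ring

theorem hasDerivAt_besselJ1 {r : ℝ} (hr : r ≠ 0) :
    HasDerivAt besselJ1 (besselJ0 r - besselJ1 r / r) r := by
  have h : HasDerivAt (fun r : ℝ => (r / 2) ^ 2) (r / 2) r := by
    refine (((hasDerivAt_id r).div_const 2).pow 2).congr_deriv ?_
    simp only [id]
    ring
  have := ((hasDerivAt_id r).div_const 2).mul ((hasDerivAt_besselSeries 1 ((r / 2) ^ 2)).comp r h)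
  refine this.congr_deriv ?_
  have h2 := besselSeries_recurrence ((r / 2) ^ 2)
  rw [besselJ0_eq]
  unfold besselJ1
  simp only [Function.comp, id]
  rw [mul_div_right_comm, div_div_cancel_left' hr]
  linear_combination (-1) * h2

theorem hasDerivAt_mul_besselJ1 (r : ℝ) :
    HasDerivAt (fun r => r * besselJ1 r) (r * besselJ0 r) r := by
  have h : HasDerivAt (fun r : ℝ => (r / 2) ^ 2) (r / 2) r := by
    refine (((hasDerivAt_id r).div_const 2).pow 2).congr_deriv ?_
    simp only [id]
    ring
  have := (hasDerivAt_id r).mul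
    (((hasDerivAt_id r).div_const 2).mul ((hasDerivAt_besselSeries 1 ((r / 2) ^ 2)).comp r h))
  refine this.congr_deriv ?_
  have h2 := besselSeries_recurrence ((r / 2) ^ 2)
  rw [besselJ0_eq]
  simp only [Function.comp, id, Pi.mul_apply]
  linear_combination (-r) * h2

theorem continuous_besselJ1 : Continuous besselJ1 := by
  have : Continuous (besselSeries 1) :=
    continuous_iff_continuousAt.2 fun s => (hasDerivAt_besselSeries 1 s).continuousAt
  unfold besselJ1
  fun_prop

theorem besselJ0_zero : besselJ0 0 = 1 := by
  rw [besselJ0_eq, besselSeries, tsum_eq_single 0]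
  · simp
  · intro m hm
    simp [hm]

/-- The energy `w'² + (1 + 1/(4r²)) w²` of `w(r) = √r J₀(r)`. -/
def besselEnergy (r : ℝ) : ℝ :=
  r * besselJ1 r ^ 2 - besselJ0 r * besselJ1 r + besselJ0 r ^ 2 / (2 * r) + r * besselJ0 r ^ 2

/-- Since w'' = -(1 + 1/(4r²)) w, only the derivative of the coefficient 1/(4r²) survives. -/
theorem hasDerivAt_besselEnergy {r : ℝ} (hr : r ≠ 0) :
    HasDerivAt besselEnergy (-besselJ0 r ^ 2 / (2 * r ^ 2)) r := by
  have h0 := hasDerivAt_besselJ0 r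
  have h1 := hasDerivAt_besselJ1 hr
  have hi := hasDerivAt_id r
  have := (((hi.mul (h1.pow 2)).sub (h0.mul h1)).add
    ((h0.pow 2).div (hi.const_mul 2) (by simpa using hr))).add (hi.mul (h0.pow 2))
  refine this.congr_deriv ?_
  simp only [id, Pi.pow_apply, Nat.cast_ofNat]
  field_simp
  ring

theorem mul_sq_besselJ0_le_besselEnergy {r : ℝ} (hr : 0 < r) :
    r * besselJ0 r ^ 2 ≤ besselEnergy r := by
  have h : besselEnergy r = r * (besselJ1 r - besselJ0 r / (2 * r)) ^ 2 +
      besselJ0 r ^ 2 / (4 * r) + r * besselJ0 r ^ 2 := by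
    unfold besselEnergy
    field_simp
    ring
  rw [h]
  have : 0 ≤ r * (besselJ1 r - besselJ0 r / (2 * r)) ^ 2 + besselJ0 r ^ 2 / (4 * r) := by
    positivity
  linarith

theorem antitoneOn_besselEnergy : AntitoneOn besselEnergy (Set.Ioi 0) := by
  refine antitoneOn_of_deriv_nonpos (convex_Ioi 0)
    (fun r hr => (hasDerivAt_besselEnergy (ne_of_gt hr)).continuousAt.continuousWithinAt) ?_ ?_
  · rw [interior_Ioi]
    exact fun r hr =>
      (hasDerivAt_besselEnergy (ne_of_gt hr)).differentiableAt.differentiableWithinAt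
  · rw [interior_Ioi]
    intro r hr
    rw [(hasDerivAt_besselEnergy (ne_of_gt hr)).deriv, neg_div]
    simp only [Left.neg_nonpos_iff]
    positivity

/-- The energy E dominates r J₀², so E' ≥ -E/(2r³), and the exponential is the integrating factor of
this inequality. Thus E cannot decay to zero. -/
theorem monotoneOn_besselEnergy_mul_exp :
    MonotoneOn (fun r => besselEnergy r * Real.exp (-1 / (4 * r ^ 2))) (Set.Ioi 0) := by
  have hd : ∀ r : ℝ, 0 < r → HasDerivAt (fun r => besselEnergy r * Real.exp (-1 / (4 * r ^ 2)))
      (-besselJ0 r ^ 2 / (2 * r ^ 2) * Real.exp (-1 / (4 * r ^ 2)) +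
        besselEnergy r * (Real.exp (-1 / (4 * r ^ 2)) * (1 / (2 * r ^ 3)))) r := by
    intro r hr
    refine (hasDerivAt_besselEnergy hr.ne').mul (HasDerivAt.exp ?_)
    have := (((hasDerivAt_id r).pow 2).const_mul 4).fun_inv (by simpa using hr.ne')
    have := this.const_mul (-1)
    simp only [id, Pi.pow_apply, ← div_eq_mul_inv] at this
    refine this.congr_deriv ?_
    field_simp
    norm_num
    ring
  refine monotoneOn_of_deriv_nonneg (convex_Ioi 0)
    (fun r hr => (hd r hr).continuousAt.continuousWithinAt) ?_ ?_
  · rw [interior_Ioi]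
    exact fun r hr => (hd r hr).differentiableAt.differentiableWithinAt
  · rw [interior_Ioi]
    intro r hr
    have hr : 0 < r := hr
    rw [(hd r hr).deriv]
    have h1 := mul_sq_besselJ0_le_besselEnergy hr
    have h2 : -besselJ0 r ^ 2 / (2 * r ^ 2) * Real.exp (-1 / (4 * r ^ 2)) +
        besselEnergy r * (Real.exp (-1 / (4 * r ^ 2)) * (1 / (2 * r ^ 3))) =
        (besselEnergy r - r * besselJ0 r ^ 2) * (Real.exp (-1 / (4 * r ^ 2)) / (2 * r ^ 3)) := by
      field_simp
      ring
    rw [h2]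
    exact mul_nonneg (by linarith) (by positivity)

theorem exists_sq_besselJ0_le : ∃ C : ℝ, 0 < C ∧ (∀ r, 0 ≤ r → besselJ0 r ^ 2 ≤ C) ∧
    ∀ r, 0 < r → r * besselJ0 r ^ 2 ≤ C := by
  obtain ⟨B, hB⟩ := isCompact_Icc.exists_bound_of_continuousOn (s := Set.Icc (0 : ℝ) 1)
    (f := fun r => besselJ0 r ^ 2) (continuous_besselJ0.pow 2).continuousOn
  have hB0 : ∀ r ∈ Set.Icc (0 : ℝ) 1, besselJ0 r ^ 2 ≤ B := fun r hr =>
    (le_abs_self _).trans (hB r hr)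
  have hE : ∀ r : ℝ, 1 ≤ r → r * besselJ0 r ^ 2 ≤ besselEnergy 1 := fun r hr =>
    (mul_sq_besselJ0_le_besselEnergy (by linarith)).trans
      (antitoneOn_besselEnergy (by simp) (Set.mem_Ioi.2 (by linarith)) hr)
  have hB1 : 0 ≤ B := (sq_nonneg _).trans (hB0 0 (by simp))
  have hE1 : 0 ≤ besselEnergy 1 := le_trans (by positivity) (hE 1 le_rfl)
  refine ⟨B + besselEnergy 1 + 1, by positivity, fun r hr => ?_, fun r hr => ?_⟩
  · rcases le_total r 1 with h | h
    · linarith [hB0 r ⟨hr, h⟩]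
    · nlinarith [hE r h, sq_nonneg (besselJ0 r)]
  · rcases le_total r 1 with h | h
    · nlinarith [hB0 r ⟨hr.le, h⟩, sq_nonneg (besselJ0 r)]
    · linarith [hE r h]

/-! ### Zeros of J₀: nondegeneracy, separation, existence -/

theorem exists_besselJ0_pos : ∃ ρ : ℝ, 0 < ρ ∧ ∀ r, 0 ≤ r → r ≤ ρ → 0 < besselJ0 r := by
  have h : ∀ᶠ r in 𝓝 (0 : ℝ), 0 < besselJ0 r :=
    continuous_besselJ0.continuousAt.eventually (lt_mem_nhds (by simp [besselJ0_zero]))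
  obtain ⟨ε, hε, h⟩ := Metric.eventually_nhds_iff.1 h
  refine ⟨ε / 2, by positivity, fun r h0 h1 => h ?_⟩
  rw [Real.dist_eq, sub_zero, abs_of_nonneg h0]
  linarith

/-- At a zero z of J₀ the energy equals z J₁(z)². It is bounded below by comparison with a fixed ρ
below all zeros, where it is positive. -/
theorem exists_le_mul_sq_besselJ1 :
    ∃ κ : ℝ, 0 < κ ∧ ∀ z, 0 < z → besselJ0 z = 0 → κ ≤ z * besselJ1 z ^ 2 := by
  obtain ⟨ρ, hρ, hpos⟩ := exists_besselJ0_pos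
  have hE : 0 < besselEnergy ρ := by
    refine lt_of_lt_of_le ?_ (mul_sq_besselJ0_le_besselEnergy hρ)
    have := hpos ρ hρ.le le_rfl
    positivity
  refine ⟨besselEnergy ρ * Real.exp (-1 / (4 * ρ ^ 2)), by positivity, fun z hz h0 => ?_⟩
  have hz' : ρ ≤ z := by
    by_contra! h
    exact (hpos z hz.le h.le).ne' h0
  have h1 := monotoneOn_besselEnergy_mul_exp hρ hz hz'
  have h2 : besselEnergy z = z * besselJ1 z ^ 2 := by simp [besselEnergy, h0]
  simp only [h2] at h1
  refine h1.trans (mul_le_of_le_one_right (by positivity) (Real.exp_le_one_iff.2 ?_))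
  rw [neg_div]
  simp only [Left.neg_nonpos_iff]
  positivity

/-- Between two zeros a < b ≤ 2a, J₁ vanishes at some c. So r J₁ must fall from a J₁(a), which is of
size at least √(κa), to 0, while its slope r J₀ is only O(√a); this takes a length bounded below. -/
theorem exists_zero_gap : ∃ δ : ℝ, 0 < δ ∧ ∀ a, 0 ≤ a → ∀ b, a < b →
    (a = 0 ∨ besselJ0 a = 0) → besselJ0 b = 0 → a + δ ≤ b := by
  obtain ⟨ρ, hρ, hpos⟩ := exists_besselJ0_pos
  obtain ⟨C, hC, -, hC1⟩ := exists_sq_besselJ0_le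
  obtain ⟨κ, hκ, hκ1⟩ := exists_le_mul_sq_besselJ1
  refine ⟨min ρ √(κ / (2 * C)), by positivity, fun a ha b hab h0 hb => ?_⟩
  have hbρ : ρ ≤ b := by
    by_contra! h
    exact (hpos b (ha.trans hab.le) h.le).ne' hb
  rcases h0 with rfl | h0
  · rw [zero_add]
    exact (min_le_left _ _).trans hbρ
  have haρ : ρ ≤ a := by
    by_contra! h
    exact (hpos a ha h.le).ne' h0
  have ha : 0 < a := by linarith
  rcases le_total b (2 * a) with hb2 | hb2
  swap
  · linarith [min_le_left ρ √(κ / (2 * C))]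
  obtain ⟨c, hc, hc0⟩ := exists_hasDerivAt_eq_zero hab continuous_besselJ0.continuousOn
    (h0.trans hb.symm) fun x _ => hasDerivAt_besselJ0 x
  obtain ⟨d, hd, hd0⟩ := exists_hasDerivAt_eq_slope (fun r => r * besselJ1 r) _ hc.1
    (by have := continuous_besselJ1; fun_prop) fun x _ => hasDerivAt_mul_besselJ1 x
  have hca : 0 < c - a := by linarith [hc.1]
  have hd1 : d * besselJ0 d * (c - a) = -(a * besselJ1 a) := by
    rw [hd0, show besselJ1 c = 0 by linarith]
    field_simp
    ring
  have h1 : a * κ ≤ (2 * a * C) * (c - a) ^ 2 := by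
    calc a * κ ≤ a * (a * besselJ1 a ^ 2) := by gcongr; exact hκ1 a ha h0
      _ = (d * besselJ0 d * (c - a)) ^ 2 := by rw [hd1]; ring
      _ = d * (d * besselJ0 d ^ 2) * (c - a) ^ 2 := by ring
      _ ≤ _ := by
        have hd' : 0 < d := by linarith [hd.1]
        gcongr
        · linarith [hd.2, hc.2]
        · exact hC1 d hd'
  have h2 : κ / (2 * C) ≤ (c - a) ^ 2 := by
    rw [div_le_iff₀ (by positivity)]
    have : a * κ ≤ a * ((c - a) ^ 2 * (2 * C)) := by linarith
    exact le_of_mul_le_mul_left this ha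
  have h3 : √(κ / (2 * C)) ≤ c - a := Real.sqrt_le_iff.2 ⟨hca.le, h2⟩
  linarith [min_le_right ρ √(κ / (2 * C)), hc.2]

/-- If f > 0 on [a, ∞), then r g is nondecreasing. Once it reaches some η > 0, f' ≤ -η/r forces f
below a negative multiple of log r. If it never becomes positive, f is nondecreasing and r f² is
unbounded. Stated for a pair (f, g) so that it applies to J₀ and to -J₀. -/
theorem not_forall_pos_of_bessel_system {f g : ℝ → ℝ} (hf : ∀ r, HasDerivAt f (-g r) r)
    (hg : ∀ r, HasDerivAt (fun r => r * g r) (r * f r) r) {C : ℝ}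
    (hC : ∀ r, 0 < r → r * f r ^ 2 ≤ C) {a : ℝ} (ha : 0 < a) : ¬ ∀ r, a ≤ r → 0 < f r := by
  intro hpos
  have hmono : MonotoneOn (fun r => r * g r) (Set.Ici a) := by
    refine monotoneOn_of_deriv_nonneg (convex_Ici a)
      (fun r _ => (hg r).continuousAt.continuousWithinAt)
      (fun r _ => (hg r).differentiableAt.differentiableWithinAt) fun r hr => ?_
    rw [interior_Ici] at hr
    have hr : a < r := hr
    rw [(hg r).deriv]
    exact mul_nonneg (by linarith) (hpos r hr.le).le
  by_cases h : ∃ b, a ≤ b ∧ 0 < b * g b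
  · obtain ⟨b, hab, hb⟩ := h
    set η := b * g b with hη
    have hb0 : 0 < b := by linarith
    have hanti : AntitoneOn (fun r => f r + η * Real.log r) (Set.Ici b) := by
      have hd : ∀ r, b ≤ r → HasDerivAt (fun r => f r + η * Real.log r) (-g r + η * r⁻¹) r :=
        fun r hr => (hf r).add ((Real.hasDerivAt_log (by linarith)).const_mul η)
      refine antitoneOn_of_deriv_nonpos (convex_Ici b)
        (fun r hr => (hd r hr).continuousAt.continuousWithinAt)
        (fun r hr => (hd r (interior_subset hr)).differentiableAt.differentiableWithinAt)
        fun r hr => ?_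
      have hr : b ≤ r := interior_subset hr
      rw [(hd r hr).deriv]
      have hr0 : 0 < r := by linarith
      have h1 : η ≤ r * g r := hmono hab (hab.trans hr) hr
      have h2 : η * r⁻¹ ≤ g r := by
        rw [← div_eq_mul_inv, div_le_iff₀ hr0]
        linarith
      linarith
    have htend : Tendsto (fun r => η * Real.log r) atTop atTop :=
      Real.tendsto_log_atTop.const_mul_atTop hb
    obtain ⟨r, hr1, hr2⟩ := ((htend.eventually_gt_atTop (f b + η * Real.log b)).and
      (eventually_ge_atTop b)).exists
    have h1 := hanti (Set.mem_Ici.2 le_rfl) (Set.mem_Ici.2 hr2) hr2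
    simp only at h1
    linarith [hpos r (hab.trans hr2)]
  · push Not at h
    have hmono : MonotoneOn f (Set.Ici a) := by
      refine monotoneOn_of_deriv_nonneg (convex_Ici a)
        (fun r _ => (hf r).continuousAt.continuousWithinAt)
        (fun r _ => (hf r).differentiableAt.differentiableWithinAt) fun r hr => ?_
      have hr : a ≤ r := interior_subset hr
      rw [(hf r).deriv]
      have := h r hr
      nlinarith
    have hfa := hpos a le_rfl
    set r := max a (C / f a ^ 2 + 1)
    have hr : a ≤ r := le_max_left _ _
    have h1 : f a ≤ f r := hmono (Set.mem_Ici.2 le_rfl) hr hr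
    have h2 : C / f a ^ 2 < r := lt_of_lt_of_le (by linarith) (le_max_right _ _)
    rw [div_lt_iff₀ (by positivity)] at h2
    have h3 : r * f a ^ 2 ≤ r * f r ^ 2 := by
      have : 0 < r := by linarith
      gcongr
    linarith [hC r (by linarith)]

theorem exists_besselJ0_eq_zero {a : ℝ} (ha : 0 ≤ a) : ∃ r, a < r ∧ besselJ0 r = 0 := by
  obtain ⟨C, hC, -, hC1⟩ := exists_sq_besselJ0_le
  by_contra! h
  have h1 := not_forall_pos_of_bessel_system hasDerivAt_besselJ0 hasDerivAt_mul_besselJ1 hC1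
    (show 0 < a + 1 by linarith)
  have h2 := not_forall_pos_of_bessel_system (f := fun r => -besselJ0 r)
    (g := fun r => -besselJ1 r) (fun r => (hasDerivAt_besselJ0 r).neg)
    (fun r => by simpa only [mul_neg] using (hasDerivAt_mul_besselJ1 r).fun_neg)
    (by simpa only [neg_sq] using hC1) (show 0 < a + 1 by linarith)
  push Not at h1 h2
  obtain ⟨r, hr, hr0⟩ := h1
  obtain ⟨s, hs, hs0⟩ := h2
  obtain ⟨t, ht, ht0⟩ := intermediate_value_uIcc (a := r) (b := s) (f := besselJ0)
    continuous_besselJ0.continuousOn (Set.mem_uIcc_of_le hr0 (by linarith))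
  refine h t ?_ ht0
  have := ht.1
  rcases le_total r s with hrs | hrs
  · rw [inf_of_le_left hrs] at this; linarith
  · rw [inf_of_le_right hrs] at this; linarith

/-- The gap makes the set of later zeros closed, so its infimum is attained. The case a = 0 starts
the recursion. -/
theorem besselZero_aux {a : ℝ} (ha : 0 ≤ a) (h : a = 0 ∨ besselJ0 a = 0) :
    a < sInf {r : ℝ | a < r ∧ besselJ0 r = 0} ∧
      besselJ0 (sInf {r : ℝ | a < r ∧ besselJ0 r = 0}) = 0 := by
  obtain ⟨δ, hδ, hgap⟩ := exists_zero_gap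
  have hset : {r : ℝ | a < r ∧ besselJ0 r = 0} = {r : ℝ | a + δ ≤ r ∧ besselJ0 r = 0} := by
    ext r
    refine ⟨fun hr => ⟨hgap a ha r hr.1 h hr.2, hr.2⟩, fun hr => ⟨?_, hr.2⟩⟩
    linarith [hr.1]
  have hclosed : IsClosed {r : ℝ | a + δ ≤ r ∧ besselJ0 r = 0} :=
    isClosed_Ici.inter (isClosed_singleton.preimage continuous_besselJ0)
  have hne : {r : ℝ | a < r ∧ besselJ0 r = 0}.Nonempty := exists_besselJ0_eq_zero ha
  exact IsClosed.csInf_mem (hset ▸ hclosed) hne ⟨a, fun r hr => hr.1.le⟩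

theorem besselZero_spec (n : ℕ) : 0 < besselZero n ∧ besselJ0 (besselZero n) = 0 := by
  induction n with
  | zero => exact besselZero_aux le_rfl (Or.inl rfl)
  | succ n ih =>
    have := besselZero_aux ih.1.le (Or.inr ih.2)
    exact ⟨ih.1.trans this.1, this.2⟩

theorem besselZero_pos (n : ℕ) : 0 < besselZero n := (besselZero_spec n).1

theorem besselJ0_besselZero (n : ℕ) : besselJ0 (besselZero n) = 0 := (besselZero_spec n).2

theorem besselZero_lt_succ (n : ℕ) : besselZero n < besselZero (n + 1) :=
  (besselZero_aux (besselZero_pos n).le (Or.inr (besselJ0_besselZero n))).1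

theorem strictMono_besselZero : StrictMono besselZero :=
  strictMono_nat_of_lt_succ besselZero_lt_succ

theorem exists_mul_le_besselZero :
    ∃ δ : ℝ, 0 < δ ∧ ∀ n : ℕ, δ * (n + 1) ≤ besselZero n := by
  obtain ⟨δ, hδ, hgap⟩ := exists_zero_gap
  refine ⟨δ, hδ, fun n => ?_⟩
  induction n with
  | zero =>
    have := hgap 0 le_rfl _ (besselZero_pos 0) (Or.inl rfl) (besselJ0_besselZero 0)
    simpa using this
  | succ n ih =>
    have := hgap _ (besselZero_pos n).le _ (besselZero_lt_succ n)
      (Or.inr (besselJ0_besselZero n)) (besselJ0_besselZero (n + 1))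
    push_cast
    linarith

/-! ### Radial integrals and orthogonality relations -/

theorem measureReal_disc_pos : 0 < (volume : Measure Plane).real disc :=
  ENNReal.toReal_pos (Metric.measure_ball_pos volume 0 one_pos).ne' measure_ball_lt_top.ne

theorem setIntegral_disc_norm (f : ℝ → ℝ) :
    ∫ x in disc, f ‖x‖ = 2 * (volume : Measure Plane).real disc * ∫ r in (0 : ℝ)..1, r * f r := by
  have h1 : ∫ x in disc, f ‖x‖ = ∫ x : Plane, (Set.Iio 1).indicator f ‖x‖ := by
    rw [← integral_indicator (show MeasurableSet disc from Metric.isOpen_ball.measurableSet)]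
    congr 1
    ext x
    by_cases hx : ‖x‖ < 1
    · rw [Set.indicator_of_mem (by simpa [disc] using hx), Set.indicator_of_mem (by simpa using hx)]
    · rw [Set.indicator_of_notMem (by simpa [disc] using hx),
        Set.indicator_of_notMem (by simpa using hx)]
  have h2 : ∀ r : ℝ, r • (Set.Iio 1).indicator f r =
      (Set.Iio 1).indicator (fun r => r * f r) r := by
    intro r
    by_cases hr : r < 1 <;> simp [Set.indicator, hr]
  rw [h1, integral_fun_norm_addHaar volume]
  simp only [finrank_euclideanSpace, Fintype.card_fin, Nat.add_one_sub_one, pow_one, h2]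
  rw [setIntegral_indicator measurableSet_Iio, Set.Ioi_inter_Iio,
    ← integral_Ioc_eq_integral_Ioo, ← intervalIntegral.integral_of_le zero_le_one]
  simp only [nsmul_eq_mul, smul_eq_mul, Nat.cast_ofNat]
  rw [mul_assoc]
  rfl

theorem integrable_disc_of_continuous {E : Type*} [NormedAddCommGroup E] {f : Plane → E}
    (hf : Continuous f) : Integrable f (volume.restrict disc) :=
  (hf.continuousOn.integrableOn_compact (isCompact_closedBall (0 : Plane) 1)).mono_set
    Metric.ball_subset_closedBall

/-- Green's identity: integrate the derivative of a r J₁(ar) J₀(br). The boundary terms vanish at r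
= 0, and at r = 1 because J₀(b) = 0. Exchanging a and b then yields orthogonality. -/
theorem intervalIntegral_besselJ1_mul (a : ℝ) {b : ℝ} (hb : besselJ0 b = 0) :
    ∫ r in (0 : ℝ)..1, r * (a * besselJ1 (a * r) * (b * besselJ1 (b * r))) =
      a ^ 2 * ∫ r in (0 : ℝ)..1, r * (besselJ0 (a * r) * besselJ0 (b * r)) := by
  have hc0 := continuous_besselJ0
  have hc1 := continuous_besselJ1
  have hd : ∀ r : ℝ, HasDerivAt (fun r => a * r * besselJ1 (a * r) * besselJ0 (b * r))
      (a ^ 2 * (r * (besselJ0 (a * r) * besselJ0 (b * r))) -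
        r * (a * besselJ1 (a * r) * (b * besselJ1 (b * r)))) r := by
    intro r
    have ha := (hasDerivAt_mul_besselJ1 (a * r)).comp r ((hasDerivAt_id r).const_mul a)
    have hb := (hasDerivAt_besselJ0 (b * r)).comp r ((hasDerivAt_id r).const_mul b)
    refine (ha.mul hb).congr_deriv ?_
    simp only [Function.comp]
    ring
  have h1 : ∀ f : ℝ → ℝ, Continuous f → IntervalIntegrable f volume 0 1 :=
    fun f hf => hf.intervalIntegrable 0 1
  have h := intervalIntegral.integral_eq_sub_of_hasDerivAt (fun r _ => hd r)
    (h1 _ (by fun_prop))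
  rw [intervalIntegral.integral_sub (h1 _ (by fun_prop)) (h1 _ (by fun_prop)),
    intervalIntegral.integral_const_mul] at h
  simp only [mul_one, hb, mul_zero, zero_mul, sub_self] at h
  linarith

theorem intervalIntegral_besselJ0_mul_of_ne {a b : ℝ} (ha : 0 < a) (hb : 0 < b) (hab : a ≠ b)
    (ha0 : besselJ0 a = 0) (hb0 : besselJ0 b = 0) :
    ∫ r in (0 : ℝ)..1, r * (besselJ0 (a * r) * besselJ0 (b * r)) = 0 := by
  have h1 := intervalIntegral_besselJ1_mul a hb0
  have h2 := intervalIntegral_besselJ1_mul b ha0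
  simp only [mul_comm (b * besselJ1 _), mul_comm (besselJ0 (b * _))] at h2
  rw [h1] at h2
  have h3 : (a - b) * (a + b) *
      ∫ r in (0 : ℝ)..1, r * (besselJ0 (a * r) * besselJ0 (b * r)) = 0 := by linear_combination h2
  simpa [sub_ne_zero.2 hab, (add_pos ha hb).ne'] using h3

theorem intervalIntegral_besselJ0_sq {a : ℝ} (ha : 0 < a) (ha0 : besselJ0 a = 0) :
    ∫ r in (0 : ℝ)..1, r * (besselJ0 (a * r) * besselJ0 (a * r)) = besselJ1 a ^ 2 / 2 := by
  have hc0 := continuous_besselJ0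
  -- An explicit antiderivative of 2a² r J₀(ar)²: the cross terms J₀J₁ of the two squares cancel.
  have hd : ∀ r : ℝ, HasDerivAt
      (fun r => (a * r * besselJ1 (a * r)) ^ 2 + (a * r * besselJ0 (a * r)) ^ 2)
      (2 * a ^ 2 * (r * (besselJ0 (a * r) * besselJ0 (a * r)))) r := by
    intro r
    have hi := (hasDerivAt_id r).const_mul a
    have h1 := (hasDerivAt_mul_besselJ1 (a * r)).comp r hi
    have h0 := (hasDerivAt_besselJ0 (a * r)).comp r hi
    refine ((h1.pow 2).add ((hi.mul h0).pow 2)).congr_deriv ?_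
    simp only [Function.comp, id, Pi.mul_apply]
    ring
  have h := intervalIntegral.integral_eq_sub_of_hasDerivAt (fun r _ => hd r)
    (Continuous.intervalIntegrable (by fun_prop) 0 1)
  rw [intervalIntegral.integral_const_mul] at h
  simp only [mul_one, ha0, mul_zero, zero_mul, ne_eq, OfNat.ofNat_ne_zero, not_false_eq_true,
    zero_pow, add_zero, sub_zero] at h
  have : a ^ 2 ≠ 0 := by positivity
  field_simp
  have h2 : a ^ 2 * (2 * ∫ r in (0 : ℝ)..1, r * (besselJ0 (a * r) * besselJ0 (a * r))) =
      a ^ 2 * besselJ1 a ^ 2 := by linarith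
  simpa [mul_comm, sq] using mul_left_cancel₀ this h2

/-- The squared norm of `J₀(zₙ|·|)` in `L²(𝔻)`. -/
def besselNormSq (n : ℕ) : ℝ := ∫ y in disc, besselJ0 (besselZero n * ‖y‖) ^ 2

theorem besselNormSq_eq (n : ℕ) :
    besselNormSq n = (volume : Measure Plane).real disc * besselJ1 (besselZero n) ^ 2 := by
  rw [besselNormSq, setIntegral_disc_norm fun r => besselJ0 (besselZero n * r) ^ 2]
  simp only [sq (besselJ0 _)]
  rw [intervalIntegral_besselJ0_sq (besselZero_pos n) (besselJ0_besselZero n)]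
  ring

theorem exists_le_mul_besselNormSq :
    ∃ κ : ℝ, 0 < κ ∧ ∀ n, κ ≤ besselZero n * besselNormSq n := by
  obtain ⟨κ, hκ, h⟩ := exists_le_mul_sq_besselJ1
  refine ⟨(volume : Measure Plane).real disc * κ, mul_pos measureReal_disc_pos hκ, fun n => ?_⟩
  have := mul_le_mul_of_nonneg_left (h _ (besselZero_pos n) (besselJ0_besselZero n))
    measureReal_disc_pos.le
  rw [besselNormSq_eq]
  linarith

theorem besselNormSq_pos (n : ℕ) : 0 < besselNormSq n := by
  obtain ⟨κ, hκ, h⟩ := exists_le_mul_besselNormSq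
  exact pos_of_mul_pos_right (hκ.trans_le (h n)) (besselZero_pos n).le

/-- The real-valued radial profile of `eₙ`. -/
def eigenProfile (n : ℕ) (r : ℝ) : ℝ := besselJ0 (besselZero n * r) / √(besselNormSq n)

/-- The radial derivative of `eₙ`, up to sign. -/
def gradProfile (n : ℕ) (r : ℝ) : ℝ :=
  besselZero n * besselJ1 (besselZero n * r) / √(besselNormSq n)

theorem eigenFun_eq (n : ℕ) (x : Plane) : eigenFun n x = (eigenProfile n ‖x‖ : ℝ) := rfl

theorem continuous_eigenProfile (n : ℕ) : Continuous (eigenProfile n) := by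
  have := continuous_besselJ0
  unfold eigenProfile
  fun_prop

theorem continuous_gradProfile (n : ℕ) : Continuous (gradProfile n) := by
  have := continuous_besselJ1
  unfold gradProfile
  fun_prop

theorem setIntegral_eigenProfile_mul (n m : ℕ) :
    ∫ x in disc, eigenProfile n ‖x‖ * eigenProfile m ‖x‖ = if n = m then 1 else 0 := by
  have h : ∀ r, r * (eigenProfile n r * eigenProfile m r) =
      (√(besselNormSq n) * √(besselNormSq m))⁻¹ * (r * (besselJ0 (besselZero n * r) * besselJ0 (besselZero m * r))) := by
    intro r
    unfold eigenProfile
    rw [div_mul_div_comm, div_eq_mul_inv]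
    ring
  rw [setIntegral_disc_norm fun r => eigenProfile n r * eigenProfile m r]
  simp only [h, intervalIntegral.integral_const_mul]
  split_ifs with hnm
  · subst hnm
    have hp := besselNormSq_pos n
    rw [intervalIntegral_besselJ0_sq (besselZero_pos n) (besselJ0_besselZero n),
      Real.mul_self_sqrt hp.le]
    have := besselNormSq_eq n
    field_simp
    linarith
  · rw [intervalIntegral_besselJ0_mul_of_ne (besselZero_pos n) (besselZero_pos m)
      (strictMono_besselZero.injective.ne hnm) (besselJ0_besselZero n) (besselJ0_besselZero m)]
    simp

theorem setIntegral_gradProfile_mul (n m : ℕ) :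
    ∫ x in disc, gradProfile n ‖x‖ * gradProfile m ‖x‖ =
      if n = m then besselZero n ^ 2 else 0 := by
  have h : ∀ r, r * (gradProfile n r * gradProfile m r) = (√(besselNormSq n) * √(besselNormSq m))⁻¹
      * (r * (besselZero n * besselJ1 (besselZero n * r) *
        (besselZero m * besselJ1 (besselZero m * r)))) := by
    intro r
    unfold gradProfile
    rw [div_mul_div_comm, div_eq_mul_inv]
    ring
  have h' : ∀ r, r * (eigenProfile n r * eigenProfile m r) =
      (√(besselNormSq n) * √(besselNormSq m))⁻¹ * (r * (besselJ0 (besselZero n * r) * besselJ0 (besselZero m * r))) := by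
    intro r
    unfold eigenProfile
    rw [div_mul_div_comm, div_eq_mul_inv]
    ring
  have key := setIntegral_eigenProfile_mul n m
  rw [setIntegral_disc_norm fun r => eigenProfile n r * eigenProfile m r] at key
  rw [setIntegral_disc_norm fun r => gradProfile n r * gradProfile m r]
  simp only [h', intervalIntegral.integral_const_mul] at key
  simp only [h, intervalIntegral.integral_const_mul]
  rw [intervalIntegral_besselJ1_mul _ (besselJ0_besselZero m)]
  rw [show (if n = m then besselZero n ^ 2 else 0) =
    besselZero n ^ 2 * (if n = m then (1 : ℝ) else 0) by simp, ← key]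
  ring

theorem orthonormal_eigenVec : Orthonormal ℂ eigenVec := by
  rw [orthonormal_iff_ite]
  intro n m
  rw [Submodule.coe_inner, L2.inner_def]
  have h : (fun x => inner ℂ ((eigenVec n : Lp ℂ 2 discMeasure) x)
      ((eigenVec m : Lp ℂ 2 discMeasure) x)) =ᵐ[discMeasure]
      fun x => ((eigenProfile n ‖x‖ * eigenProfile m ‖x‖ : ℝ) : ℂ) := by
    filter_upwards [(memLp_eigenFun n).coeFn_toLp, (memLp_eigenFun m).coeFn_toLp] with x h1 h2
    simp only [eigenVec]
    rw [h1, h2, eigenFun_eq, eigenFun_eq, RCLike.inner_apply, Complex.conj_ofReal]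
    push_cast
    ring
  rw [integral_congr_ae h]
  have h2 : ∫ x, ((eigenProfile n ‖x‖ * eigenProfile m ‖x‖ : ℝ) : ℂ) ∂discMeasure =
      ((∫ x in disc, eigenProfile n ‖x‖ * eigenProfile m ‖x‖ : ℝ) : ℂ) := integral_ofReal
  rw [h2, setIntegral_eigenProfile_mul]
  split_ifs <;> simp

/-- The bounds J₀² ≤ C and s J₀² ≤ C are interpolated to C s^(-3/4), and the normalization costs one
factor z_n. The exponent 3/4 is a compromise: decay r^(-1) would have a non-integrable square on the
disc, and no decay would leave a divergent sum of 1/z_n in the variance. -/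
theorem exists_sq_eigenProfile_le : ∃ C : ℝ, 0 < C ∧ ∀ n r, 0 < r →
    eigenProfile n r ^ 2 ≤ C * besselZero n ^ (1 / 4 : ℝ) * r ^ (-(3 / 4) : ℝ) := by
  obtain ⟨C, hC, hC0, hC1⟩ := exists_sq_besselJ0_le
  obtain ⟨κ, hκ, hκ1⟩ := exists_le_mul_besselNormSq
  refine ⟨C / κ, by positivity, fun n r hr => ?_⟩
  have hz := besselZero_pos n
  have hp := besselNormSq_pos n
  have hJ : ∀ s : ℝ, 0 < s → besselJ0 s ^ 2 ≤ C * s ^ (-(3 / 4) : ℝ) := by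
    intro s hs
    rcases le_total s 1 with h | h
    · refine (hC0 s hs.le).trans (le_mul_of_one_le_right hC.le ?_)
      exact Real.one_le_rpow_of_pos_of_le_one_of_nonpos hs h (by norm_num)
    · calc besselJ0 s ^ 2 ≤ C * s ^ (-1 : ℝ) := by
            rw [Real.rpow_neg_one, ← div_eq_mul_inv, le_div_iff₀ hs]
            linarith [hC1 s hs]
        _ ≤ _ := by
            gcongr
            norm_num
  have h1 : 1 / besselNormSq n ≤ besselZero n / κ := by
    rw [div_le_div_iff₀ hp hκ]
    linarith [hκ1 n]
  calc eigenProfile n r ^ 2 = besselJ0 (besselZero n * r) ^ 2 * (1 / besselNormSq n) := by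
        rw [eigenProfile, div_pow, Real.sq_sqrt hp.le, div_eq_mul_one_div]
    _ ≤ C * (besselZero n * r) ^ (-(3 / 4) : ℝ) * (besselZero n / κ) := by
        gcongr
        exact hJ _ (mul_pos hz hr)
    _ = _ := by
        rw [Real.mul_rpow hz.le hr.le, show (1 / 4 : ℝ) = 1 + -(3 / 4) by norm_num,
          Real.rpow_add hz, Real.rpow_one]
        ring

/-! ### Parseval identity and the kinetic energy of projections -/

theorem setIntegral_norm_sum_sq {f : ℕ → ℝ → ℝ} {l : ℕ → ℝ} (hf : ∀ n, Continuous (f n))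
    (h : ∀ n m, ∫ x in disc, f n ‖x‖ * f m ‖x‖ = if n = m then l n else 0) (c : ℕ → ℂ) (N : ℕ) :
    ∫ x in disc, ‖∑ n ∈ Finset.range N, c n * (f n ‖x‖ : ℂ)‖ ^ 2 =
      ∑ n ∈ Finset.range N, l n * ‖c n‖ ^ 2 := by
  have hreal : ∀ a : ℕ → ℝ, ∫ x in disc, (∑ n ∈ Finset.range N, a n * f n ‖x‖) ^ 2 =
      ∑ n ∈ Finset.range N, l n * a n ^ 2 := by
    intro a
    have h1 : ∀ x : Plane, (∑ n ∈ Finset.range N, a n * f n ‖x‖) ^ 2 =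
        ∑ n ∈ Finset.range N, ∑ m ∈ Finset.range N, a n * a m * (f n ‖x‖ * f m ‖x‖) := by
      intro x
      rw [sq, Finset.sum_mul_sum]
      exact Finset.sum_congr rfl fun n _ => Finset.sum_congr rfl fun m _ => by ring
    simp only [h1]
    rw [integral_finsetSum _ fun n _ => integrable_disc_of_continuous (by fun_prop)]
    refine Finset.sum_congr rfl fun n hn => ?_
    rw [integral_finsetSum _ fun m _ => integrable_disc_of_continuous (by fun_prop)]
    simp only [integral_const_mul, h]
    simp only [mul_ite, mul_zero, Finset.sum_ite_eq, hn, if_true]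
    ring
  have h2 : ∀ x : Plane, ‖∑ n ∈ Finset.range N, c n * (f n ‖x‖ : ℂ)‖ ^ 2 =
      (∑ n ∈ Finset.range N, (c n).re * f n ‖x‖) ^ 2 +
        (∑ n ∈ Finset.range N, (c n).im * f n ‖x‖) ^ 2 := by
    intro x
    rw [← Complex.normSq_eq_norm_sq, Complex.normSq_apply, Complex.re_sum, Complex.im_sum]
    simp only [Complex.re_mul_ofReal, Complex.im_mul_ofReal]
    ring
  simp only [h2]
  rw [integral_add (integrable_disc_of_continuous (by fun_prop))
    (integrable_disc_of_continuous (by fun_prop)), hreal, hreal, ← Finset.sum_add_distrib]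
  refine Finset.sum_congr rfl fun n _ => ?_
  rw [← Complex.normSq_eq_norm_sq, Complex.normSq_apply]
  ring

/-- As J₀ is an entire function of r², the gradient of e_n is ψ x with ψ finite even at the origin,
so the nondifferentiability of the norm there plays no role. -/
theorem exists_hasFDerivAt_eigenFun (n : ℕ) (x : Plane) : ∃ ψ : ℝ,
    ‖x‖ * ψ = -gradProfile n ‖x‖ ∧ ∃ L : Plane →L[ℝ] ℂ, HasFDerivAt (eigenFun n) L x ∧
      ∀ i : Fin 2, L (EuclideanSpace.single i 1) = ((ψ * x i : ℝ) : ℂ) := by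
  set z := besselZero n
  have h1 : HasFDerivAt (fun x : Plane => ‖x‖ ^ 2) (2 • innerSL ℝ x) x :=
    (hasStrictFDerivAt_norm_sq x).hasFDerivAt
  have h2 := (hasDerivAt_besselSeries 0 ((z / 2) ^ 2 * ‖x‖ ^ 2)).comp_hasFDerivAt x
    (h1.const_mul ((z / 2) ^ 2))
  have h3 := Complex.ofRealCLM.hasFDerivAt.comp x (h2.mul_const (√(besselNormSq n))⁻¹)
  refine ⟨-(z ^ 2 / 2 * besselSeries 1 ((z / 2) ^ 2 * ‖x‖ ^ 2) / √(besselNormSq n)), ?_, _,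
    h3.congr_of_eventuallyEq (.of_forall fun y => ?_), fun i => ?_⟩
  · rw [gradProfile, besselJ1, show (z * ‖x‖ / 2) ^ 2 = (z / 2) ^ 2 * ‖x‖ ^ 2 by ring]
    ring
  · rw [eigenFun_eq, eigenProfile, besselJ0_eq,
      show (z * ‖y‖ / 2) ^ 2 = (z / 2) ^ 2 * ‖y‖ ^ 2 by ring, div_eq_mul_inv]
    rfl
  · simp [EuclideanSpace.inner_single_right]
    ring

theorem gradSq_projLE (N : ℕ) (u : L2Rad) (x : Plane) :
    gradSq (projLE N u) x =
      ‖∑ n ∈ Finset.range N, inner ℂ (eigenVec n) u * (gradProfile n ‖x‖ : ℂ)‖ ^ 2 := by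
  choose ψ hψ L hL hLi using fun n => exists_hasFDerivAt_eigenFun n x
  have h1 : HasFDerivAt (projLE N u)
      (∑ n ∈ Finset.range N, inner ℂ (eigenVec n) u • L n) x :=
    HasFDerivAt.fun_sum fun n _ => (hL n).const_mul _
  set S := ∑ n ∈ Finset.range N, inner ℂ (eigenVec n) u * (ψ n : ℂ) with hS
  have h2 : ∀ i : Fin 2, fderiv ℝ (projLE N u) x (EuclideanSpace.single i 1) = S * (x i : ℂ) := by
    intro i
    rw [h1.fderiv, hS, sum_apply, Finset.sum_mul]
    refine Finset.sum_congr rfl fun n _ => ?_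
    rw [smul_apply, hLi, smul_eq_mul]
    push_cast
    ring
  have h3 : ∑ n ∈ Finset.range N, inner ℂ (eigenVec n) u * (gradProfile n ‖x‖ : ℂ) =
      -(S * (‖x‖ : ℂ)) := by
    rw [hS, Finset.sum_mul, ← Finset.sum_neg_distrib]
    refine Finset.sum_congr rfl fun n _ => ?_
    rw [← neg_eq_iff_eq_neg.2 (hψ n)]
    push_cast
    ring
  simp only [gradSq, h2, h3, norm_neg, norm_mul, mul_pow, Complex.norm_real, Real.norm_eq_abs,
    sq_abs, ← Finset.mul_sum]
  rw [EuclideanSpace.norm_sq_eq]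
  simp

theorem setIntegral_gradSq_projLE (N : ℕ) (u : L2Rad) :
    ∫ x in disc, gradSq (projLE N u) x =
      ∑ n ∈ Finset.range N, besselZero n ^ 2 * ‖inner ℂ (eigenVec n) u‖ ^ 2 := by
  simp only [gradSq_projLE]
  exact setIntegral_norm_sum_sq continuous_gradProfile setIntegral_gradProfile_mul _ N

/-! ### Gaussian estimates -/

instance (v : ℝ≥0) : IsProbabilityMeasure (gaussianSeq v) := by
  unfold gaussianSeq
  infer_instance

theorem lintegral_gaussianSeq_prod (v : ℝ≥0) (s : Finset ℕ) {φ : ℕ → ℂ → ℝ≥0∞}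
    (hφ : ∀ n, Measurable (φ n)) :
    ∫⁻ g, ∏ n ∈ s, φ n (g n) ∂gaussianSeq v = ∏ n ∈ s, ∫⁻ z, φ n z ∂complexGaussian v := by
  have h := lintegral_prod_eq_prod_lintegral_of_indepFun (μ := gaussianSeq v) s
    (fun n g => φ n (g n)) (iIndepFun_infinitePi hφ)
    (fun n => (hφ n).comp (measurable_pi_apply n))
  rw [h]
  refine Finset.prod_congr rfl fun n _ => ?_
  rw [← lintegral_map (μ := gaussianSeq v) (hφ n) (measurable_pi_apply n), gaussianSeq,
    Measure.infinitePi_map_eval]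

theorem lintegral_gaussianSeq_eval (v : ℝ≥0) (n : ℕ) {φ : ℂ → ℝ≥0∞} (hφ : Measurable φ) :
    ∫⁻ g, φ (g n) ∂gaussianSeq v = ∫⁻ z, φ z ∂complexGaussian v := by
  simpa using lintegral_gaussianSeq_prod v {n} (φ := fun _ => φ) fun _ => hφ

theorem map_re_complexGaussian (v : ℝ≥0) :
    (complexGaussian v).map Complex.re = gaussianReal 0 v := by
  rw [complexGaussian, Measure.map_map Complex.measurable_re (by fun_prop)]
  exact Measure.map_fst_prod.trans (by simp)

theorem map_im_complexGaussian (v : ℝ≥0) :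
    (complexGaussian v).map Complex.im = gaussianReal 0 v := by
  rw [complexGaussian, Measure.map_map Complex.measurable_im (by fun_prop)]
  exact Measure.map_snd_prod.trans (by simp)

theorem lintegral_exp_mul_gaussianReal (v : ℝ≥0) (t : ℝ) :
    ∫⁻ x, ENNReal.ofReal (Real.exp (t * x)) ∂gaussianReal 0 v =
      ENNReal.ofReal (Real.exp (v * t ^ 2 / 2)) := by
  rw [← ofReal_integral_eq_lintegral_ofReal (integrable_exp_mul_gaussianReal t)
    (.of_forall fun x => (Real.exp_pos _).le)]
  have := congrFun (mgf_id_gaussianReal (μ := 0) (v := v)) t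
  simp only [mgf, id, zero_mul, zero_add] at this
  rw [this]

theorem lintegral_exp_sum_gaussianSeq {v : ℝ≥0} {ℓ : ℂ → ℝ} (hℓ : Measurable ℓ)
    (hmap : (complexGaussian v).map ℓ = gaussianReal 0 v) (s : Finset ℕ) (a : ℕ → ℝ) (t : ℝ) :
    ∫⁻ g, ENNReal.ofReal (Real.exp (t * ∑ n ∈ s, a n * ℓ (g n))) ∂gaussianSeq v =
      ENNReal.ofReal (Real.exp (v * t ^ 2 * (∑ n ∈ s, a n ^ 2) / 2)) := by
  have h1 : ∀ g : ℕ → ℂ, ENNReal.ofReal (Real.exp (t * ∑ n ∈ s, a n * ℓ (g n))) =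
      ∏ n ∈ s, ENNReal.ofReal (Real.exp (t * a n * ℓ (g n))) := by
    intro g
    rw [← ENNReal.ofReal_prod_of_nonneg fun n _ => (Real.exp_pos _).le, ← Real.exp_sum,
      Finset.mul_sum]
    simp only [mul_assoc]
  simp only [h1]
  rw [lintegral_gaussianSeq_prod v s (φ := fun n z => ENNReal.ofReal (Real.exp (t * a n * ℓ z)))
    (fun n => by fun_prop)]
  have h2 : ∀ n, ∫⁻ z, ENNReal.ofReal (Real.exp (t * a n * ℓ z)) ∂complexGaussian v =
      ENNReal.ofReal (Real.exp (v * (t * a n) ^ 2 / 2)) := by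
    intro n
    rw [← lintegral_exp_mul_gaussianReal v, ← hmap, lintegral_map (by fun_prop) hℓ]
  simp only [h2]
  rw [← ENNReal.ofReal_prod_of_nonneg fun n _ => (Real.exp_pos _).le, ← Real.exp_sum,
    Finset.mul_sum, Finset.sum_div]
  simp only [mul_pow, mul_assoc]

/-- Bound S^(2j) by (2j)! t^(-2j) (exp(tS) + exp(-tS)) and use the Gaussian exponential moment. Only
the growth j^j ρ^j matters later; the constants are crude. -/
theorem lintegral_sum_pow_gaussianSeq_le {v : ℝ≥0} {ℓ : ℂ → ℝ} (hℓ : Measurable ℓ)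
    (hmap : (complexGaussian v).map ℓ = gaussianReal 0 v) (s : Finset ℕ) (a : ℕ → ℝ) {ρ : ℝ}
    (hρ : 0 < ρ) (ha : ∑ n ∈ s, a n ^ 2 ≤ ρ) {j : ℕ} (hj : 0 < j) :
    ∫⁻ g, ENNReal.ofReal ((∑ n ∈ s, a n * ℓ (g n)) ^ (2 * j)) ∂gaussianSeq v ≤
      ENNReal.ofReal (2 * (2 * j * Real.exp v * ρ) ^ j) := by
  have hj' : (0 : ℝ) < 2 * j := by positivity
  -- With this t the Gaussian moment is at most exp(v)^j, and (2j)! ≤ (2j)^(2j) gives (2j)!/t^(2j) ≤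
  -- (2jρ)^j.
  set t := √(2 * j / ρ) with ht
  have ht2 : t ^ 2 = 2 * j / ρ := Real.sq_sqrt (by positivity)
  set c : ℝ := (2 * j).factorial / t ^ (2 * j) with hc
  have ht0 : 0 < t := Real.sqrt_pos.2 (by positivity)
  have hc0 : 0 ≤ c := by positivity
  have hpt : ∀ S : ℝ, ENNReal.ofReal (S ^ (2 * j)) ≤ ENNReal.ofReal c *
      (ENNReal.ofReal (Real.exp (t * S)) + ENNReal.ofReal (Real.exp (-t * S))) := by
    intro S
    rw [← ENNReal.ofReal_add (Real.exp_pos _).le (Real.exp_pos _).le, ← ENNReal.ofReal_mul hc0]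
    refine ENNReal.ofReal_le_ofReal ?_
    have h1 := Real.pow_div_factorial_le_exp |t * S| (abs_nonneg _) (2 * j)
    rw [Even.pow_abs (even_two_mul j), mul_pow] at h1
    have h2 : Real.exp |t * S| ≤ Real.exp (t * S) + Real.exp (-t * S) := by
      rcases abs_choice (t * S) with h | h <;> rw [h]
      · linarith [Real.exp_pos (-t * S)]
      · rw [neg_mul]
        linarith [Real.exp_pos (t * S)]
    calc S ^ (2 * j) = c * (t ^ (2 * j) * S ^ (2 * j) / (2 * j).factorial) := by
          rw [hc]
          field_simp
      _ ≤ _ := by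
          gcongr
          exact h1.trans h2
  have hexp : ∀ t' : ℝ, t' ^ 2 = t ^ 2 →
      ∫⁻ g, ENNReal.ofReal (Real.exp (t' * ∑ n ∈ s, a n * ℓ (g n)))
      ∂gaussianSeq v ≤ ENNReal.ofReal (Real.exp v ^ j) := by
    intro t' ht'
    rw [lintegral_exp_sum_gaussianSeq hℓ hmap, ← Real.exp_nat_mul, ht', ht2]
    refine ENNReal.ofReal_le_ofReal (Real.exp_le_exp.2 ?_)
    calc (v : ℝ) * (2 * j / ρ) * (∑ n ∈ s, a n ^ 2) / 2 ≤ v * (2 * j / ρ) * ρ / 2 := by gcongr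
      _ = j * v := by field_simp
  calc ∫⁻ g, ENNReal.ofReal ((∑ n ∈ s, a n * ℓ (g n)) ^ (2 * j)) ∂gaussianSeq v
      ≤ ∫⁻ g, ENNReal.ofReal c * (ENNReal.ofReal (Real.exp (t * ∑ n ∈ s, a n * ℓ (g n))) +
        ENNReal.ofReal (Real.exp (-t * ∑ n ∈ s, a n * ℓ (g n)))) ∂gaussianSeq v :=
        lintegral_mono fun g => hpt _
    _ ≤ ENNReal.ofReal c * (ENNReal.ofReal (Real.exp v ^ j) + ENNReal.ofReal (Real.exp v ^ j)) := by
        rw [lintegral_const_mul _ (by fun_prop), lintegral_add_left (by fun_prop)]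
        gcongr
        · exact hexp t rfl
        · exact hexp (-t) (neg_sq t)
    _ = ENNReal.ofReal (c * (2 * Real.exp v ^ j)) := by
        rw [← ENNReal.ofReal_add (by positivity) (by positivity), ← ENNReal.ofReal_mul hc0]
        congr 1
        ring
    _ ≤ _ := by
        refine ENNReal.ofReal_le_ofReal ?_
        have h1 : c ≤ (2 * j * ρ) ^ j := by
          rw [hc, div_le_iff₀ (by positivity), pow_mul, ht2, ← mul_pow]
          have : (2 * j * ρ * (2 * j / ρ) : ℝ) = (2 * j) ^ 2 := by field_simp
          rw [this, ← pow_mul]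
          exact_mod_cast Nat.factorial_le_pow (2 * j)
        calc c * (2 * Real.exp v ^ j) ≤ (2 * j * ρ) ^ j * (2 * Real.exp v ^ j) := by gcongr
          _ = _ := by
            rw [mul_left_comm, ← mul_pow]
            ring_nf

theorem lintegral_norm_sum_pow_gaussianSeq_le {v : ℝ≥0} (s : Finset ℕ) (a : ℕ → ℝ) {ρ : ℝ}
    (hρ : 0 < ρ) (ha : ∑ n ∈ s, a n ^ 2 ≤ ρ) {j : ℕ} (hj : 0 < j) :
    ∫⁻ g, ‖∑ n ∈ s, g n * (a n : ℂ)‖ₑ ^ (2 * j) ∂gaussianSeq v ≤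
      ENNReal.ofReal (4 * (4 * j * Real.exp v * ρ) ^ j) := by
  have hpt : ∀ g : ℕ → ℂ, ‖∑ n ∈ s, g n * (a n : ℂ)‖ₑ ^ (2 * j) ≤
      ENNReal.ofReal (2 ^ j) * (ENNReal.ofReal ((∑ n ∈ s, a n * (g n).re) ^ (2 * j)) +
        ENNReal.ofReal ((∑ n ∈ s, a n * (g n).im) ^ (2 * j))) := by
    intro g
    have he : ∀ x : ℝ, 0 ≤ x ^ (2 * j) := fun x => (even_two_mul j).pow_nonneg x
    rw [← ofReal_norm, ← ENNReal.ofReal_pow (norm_nonneg _), ← ENNReal.ofReal_add (he _) (he _),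
      ← ENNReal.ofReal_mul (by positivity)]
    refine ENNReal.ofReal_le_ofReal ?_
    have h1 : ‖∑ n ∈ s, g n * (a n : ℂ)‖ ^ 2 =
        (∑ n ∈ s, a n * (g n).re) ^ 2 + (∑ n ∈ s, a n * (g n).im) ^ 2 := by
      rw [← Complex.normSq_eq_norm_sq, Complex.normSq_apply, Complex.re_sum, Complex.im_sum]
      simp only [Complex.re_mul_ofReal, Complex.im_mul_ofReal, mul_comm (a _)]
      ring
    rw [pow_mul, h1, pow_mul, pow_mul]
    refine (add_pow_le (sq_nonneg _) (sq_nonneg _) j).trans ?_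
    gcongr
    · norm_num
    · exact Nat.sub_le j 1
  calc ∫⁻ g, ‖∑ n ∈ s, g n * (a n : ℂ)‖ₑ ^ (2 * j) ∂gaussianSeq v
      ≤ _ := lintegral_mono hpt
    _ ≤ ENNReal.ofReal (2 ^ j) * (ENNReal.ofReal (2 * (2 * j * Real.exp v * ρ) ^ j) +
        ENNReal.ofReal (2 * (2 * j * Real.exp v * ρ) ^ j)) := by
        rw [lintegral_const_mul _ (by fun_prop), lintegral_add_left (by fun_prop)]
        gcongr
        · exact lintegral_sum_pow_gaussianSeq_le Complex.measurable_re (map_re_complexGaussian v)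
            s a hρ ha hj
        · exact lintegral_sum_pow_gaussianSeq_le Complex.measurable_im (map_im_complexGaussian v)
            s a hρ ha hj
    _ = _ := by
        rw [← ENNReal.ofReal_add (by positivity) (by positivity),
          ← ENNReal.ofReal_mul (by positivity),
          show (4 * j * Real.exp v * ρ : ℝ) = 2 * (2 * j * Real.exp v * ρ) by ring,
          mul_pow 2 (2 * j * Real.exp v * ρ)]
        congr 1
        ring

theorem lintegral_exp_sq_gaussianReal_lt_top {v : ℝ≥0} (hv : v ≠ 0) {θ : ℝ}
    (hθ : θ < 1 / (2 * v)) :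
    ∫⁻ x, ENNReal.ofReal (Real.exp (θ * x ^ 2)) ∂gaussianReal 0 v < ∞ := by
  rw [gaussianReal_of_var_ne_zero 0 hv, lintegral_withDensity_eq_lintegral_mul _
    (measurable_gaussianPDF 0 v) (by fun_prop)]
  have h1 : ∀ x : ℝ, (gaussianPDF 0 v * fun x => ENNReal.ofReal (Real.exp (θ * x ^ 2))) x =
      ENNReal.ofReal ((√(2 * Real.pi * v))⁻¹ * Real.exp (-(1 / (2 * v) - θ) * x ^ 2)) := by
    intro x
    rw [Pi.mul_apply, gaussianPDF, ← ENNReal.ofReal_mul (gaussianPDFReal_nonneg _ _ _),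
      gaussianPDFReal, mul_assoc, ← Real.exp_add]
    congr 3
    ring
  simp only [h1]
  exact (((integrable_exp_neg_mul_sq (by linarith)).const_mul _).lintegral_lt_top)

theorem lintegral_exp_normSq_complexGaussian_lt_top {v : ℝ≥0} (hv : v ≠ 0) {θ : ℝ}
    (hθ : θ < 1 / (2 * v)) :
    ∫⁻ z, ENNReal.ofReal (Real.exp (θ * ‖z‖ ^ 2)) ∂complexGaussian v < ∞ := by
  rw [complexGaussian, lintegral_map (by fun_prop) (by fun_prop)]
  have h1 : ∀ p : ℝ × ℝ, ENNReal.ofReal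
      (Real.exp (θ * ‖Complex.measurableEquivRealProd.symm p‖ ^ 2)) =
      ENNReal.ofReal (Real.exp (θ * p.1 ^ 2)) * ENNReal.ofReal (Real.exp (θ * p.2 ^ 2)) := by
    intro p
    rw [← ENNReal.ofReal_mul (Real.exp_pos _).le, ← Real.exp_add, ← Complex.normSq_eq_norm_sq,
      Complex.normSq_apply]
    simp only [Complex.measurableEquivRealProd_symm_apply]
    congr 2
    ring
  simp only [h1]
  rw [lintegral_prod_mul (f := fun x => ENNReal.ofReal (Real.exp (θ * x ^ 2)))
    (g := fun x => ENNReal.ofReal (Real.exp (θ * x ^ 2))) (by fun_prop) (by fun_prop)]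
  exact ENNReal.mul_lt_top (lintegral_exp_sq_gaussianReal_lt_top hv hθ)
    (lintegral_exp_sq_gaussianReal_lt_top hv hθ)

theorem lintegral_exp_sum_normSq_gaussianSeq (v : ℝ≥0) (θ : ℝ) (N : ℕ) :
    ∫⁻ g, ENNReal.ofReal (Real.exp (θ * ∑ n ∈ Finset.range N, ‖g n‖ ^ 2)) ∂gaussianSeq v =
      (∫⁻ z, ENNReal.ofReal (Real.exp (θ * ‖z‖ ^ 2)) ∂complexGaussian v) ^ N := by
  have h1 : ∀ g : ℕ → ℂ, ENNReal.ofReal (Real.exp (θ * ∑ n ∈ Finset.range N, ‖g n‖ ^ 2)) =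
      ∏ n ∈ Finset.range N, ENNReal.ofReal (Real.exp (θ * ‖g n‖ ^ 2)) := by
    intro g
    rw [← ENNReal.ofReal_prod_of_nonneg fun n _ => (Real.exp_pos _).le, ← Real.exp_sum,
      Finset.mul_sum]
  simp only [h1]
  rw [lintegral_gaussianSeq_prod v _ (φ := fun _ z => ENNReal.ofReal (Real.exp (θ * ‖z‖ ^ 2)))
    (fun _ => by fun_prop)]
  simp

theorem lintegral_normSq_complexGaussian_lt_top {v : ℝ≥0} (hv : v ≠ 0) :
    ∫⁻ z, ENNReal.ofReal (‖z‖ ^ 2) ∂complexGaussian v < ∞ := by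
  set θ : ℝ := 1 / (4 * v)
  have hv' : (0 : ℝ) < v := NNReal.coe_pos.2 (pos_iff_ne_zero.2 hv)
  have hθ : 0 < θ := by positivity
  have h1 : θ < 1 / (2 * v) := one_div_lt_one_div_of_lt (by positivity) (by linarith)
  have h2 := ENNReal.mul_lt_top (ENNReal.ofReal_lt_top (r := θ⁻¹))
    (lintegral_exp_normSq_complexGaussian_lt_top hv h1)
  rw [← lintegral_const_mul _ (by fun_prop)] at h2
  refine lt_of_le_of_lt (lintegral_mono fun z => ?_) h2
  rw [← ENNReal.ofReal_mul (by positivity)]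
  refine ENNReal.ofReal_le_ofReal ?_
  rw [← div_eq_inv_mul, le_div_iff₀ hθ, mul_comm]
  linarith [Real.add_one_le_exp (θ * ‖z‖ ^ 2)]

/-! ### The random series -/

theorem summable_inv_sq_besselZero : Summable fun n => 1 / besselZero n ^ 2 := by
  obtain ⟨δ, hδ, h⟩ := exists_mul_le_besselZero
  have h1 : Summable fun n : ℕ => 1 / δ ^ 2 * (1 / ((n + 1 : ℕ) : ℝ) ^ 2) :=
    ((summable_nat_add_iff 1).2 (Real.summable_one_div_nat_pow.2 one_lt_two)).mul_left _
  refine Summable.of_nonneg_of_le (fun n => by positivity) (fun n => ?_) h1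
  rw [one_div_mul_one_div, ← mul_pow]
  refine one_div_le_one_div_of_le (by positivity) ?_
  gcongr
  exact_mod_cast h n

theorem ae_summable_normSq_gaussianSeq {v : ℝ≥0} (hv : v ≠ 0) :
    ∀ᵐ g ∂gaussianSeq v, Summable fun n => ‖g n / (besselZero n : ℂ)‖ ^ 2 := by
  have hm : ∀ n, Measurable fun g : ℕ → ℂ =>
      ENNReal.ofReal (‖g n / (besselZero n : ℂ)‖ ^ 2) := fun n => by fun_prop
  have h1 : ∫⁻ g, ∑' n, ENNReal.ofReal (‖g n / (besselZero n : ℂ)‖ ^ 2) ∂gaussianSeq v ≠ ∞ := by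
    rw [lintegral_tsum fun n => (hm n).aemeasurable]
    have h2 : ∀ n, ∫⁻ g, ENNReal.ofReal (‖g n / (besselZero n : ℂ)‖ ^ 2) ∂gaussianSeq v =
        ENNReal.ofReal (1 / besselZero n ^ 2) *
          ∫⁻ z, ENNReal.ofReal (‖z‖ ^ 2) ∂complexGaussian v := by
      intro n
      rw [← lintegral_const_mul _ (by fun_prop), ← lintegral_gaussianSeq_eval v n (by fun_prop)]
      refine lintegral_congr fun g => ?_
      rw [← ENNReal.ofReal_mul (by positivity), norm_div, div_pow, Complex.norm_real,
        Real.norm_eq_abs, sq_abs]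
      congr 1
      ring
    simp only [h2]
    rw [ENNReal.tsum_mul_right]
    exact ENNReal.mul_ne_top summable_inv_sq_besselZero.tsum_ofReal_ne_top
      (lintegral_normSq_complexGaussian_lt_top hv).ne
  filter_upwards [ae_lt_top (Measurable.tsum hm) h1] with g hg
  have := ENNReal.summable_toReal hg.ne
  simpa only [ENNReal.toReal_ofReal (sq_nonneg _)] using this

/-- The partial sums of the random series. -/
def partialSeries (g : ℕ → ℂ) (N : ℕ) : L2Rad :=
  ∑ n ∈ Finset.range N, (g n / (besselZero n : ℂ)) • eigenVec n

theorem tendsto_partialSeries {g : ℕ → ℂ}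
    (hg : Summable fun n => ‖g n / (besselZero n : ℂ)‖ ^ 2) :
    Tendsto (partialSeries g) atTop (𝓝 (randomSeries g)) := by
  have h := (orthonormal_eigenVec.orthogonalFamily.summable_iff_norm_sq_summable
    fun n => g n / (besselZero n : ℂ)).2 hg
  simp only [LinearIsometry.toSpanSingleton_apply] at h
  exact tendsto_nhds_limUnder ⟨_, h.hasSum.tendsto_sum_nat⟩

theorem inner_eigenVec_partialSeries (g : ℕ → ℂ) {n N : ℕ} (h : n < N) :
    inner ℂ (eigenVec n) (partialSeries g N) = g n / (besselZero n : ℂ) := by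
  rw [partialSeries, orthonormal_eigenVec.inner_right_sum _ (Finset.mem_range.2 h)]

theorem inner_eigenVec_randomSeries {g : ℕ → ℂ}
    (hg : Summable fun n => ‖g n / (besselZero n : ℂ)‖ ^ 2) (n : ℕ) :
    inner ℂ (eigenVec n) (randomSeries g) = g n / (besselZero n : ℂ) := by
  refine tendsto_nhds_unique ((tendsto_const_nhds (x := eigenVec n)).inner
    (tendsto_partialSeries hg)) (tendsto_const_nhds.congr' ?_)
  filter_upwards [eventually_gt_atTop n] with N hN
  exact (inner_eigenVec_partialSeries g hN).symm

/-! ### Tail estimates -/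

/-- The block `∑_{N ≤ n < M} (gₙ / zₙ) eₙ(x)` of the random series. -/
def seriesBlock (N M : ℕ) (g : ℕ → ℂ) (x : Plane) : ℂ :=
  ∑ n ∈ Finset.Ico N M, g n * ((eigenProfile n ‖x‖ / besselZero n : ℝ) : ℂ)

theorem measurable_seriesBlock (N M : ℕ) :
    Measurable fun p : (ℕ → ℂ) × Plane => seriesBlock N M p.1 p.2 := by
  unfold seriesBlock
  refine Finset.measurable_fun_sum _ fun n _ => ?_
  have := (continuous_eigenProfile n).measurable
  have h1 : Measurable fun p : (ℕ → ℂ) × Plane => p.1 n := by fun_prop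
  exact h1.mul (by fun_prop)

/-- The fourth power of the `L⁴(𝔻)` norm of a block of the random series. -/
def blockFour (N M : ℕ) (g : ℕ → ℂ) : ℝ≥0∞ := ∫⁻ x in disc, ‖seriesBlock N M g x‖ₑ ^ 4

theorem measurable_blockFour (N M : ℕ) : Measurable (blockFour N M) :=
  Measurable.lintegral_prod_right' ((measurable_seriesBlock N M).enorm.pow_const 4)

/-- An upper bound for the fourth power of the `L⁴(𝔻)` norm of the tail of the random series. -/
def tailFour (N : ℕ) (g : ℕ → ℂ) : ℝ≥0∞ := liminf (fun M => blockFour N M g) atTop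

theorem measurable_tailFour (N : ℕ) : Measurable (tailFour N) :=
  Measurable.liminf fun M => measurable_blockFour N M

/-- The event that the tail beyond `N` is large. -/
def largeTail (N : ℕ) : Set (ℕ → ℂ) := {g | (N : ℝ≥0∞) < tailFour N g}

theorem measurableSet_largeTail (N : ℕ) : MeasurableSet (largeTail N) :=
  measurableSet_lt measurable_const (measurable_tailFour N)

theorem lintegral_norm_rpow_disc_lt_top :
    ∫⁻ x in disc, ENNReal.ofReal (‖x‖ ^ (-(3 / 2) : ℝ)) < ∞ := by
  have h : IntegrableOn (fun x : Plane => ‖x‖ ^ (-(3 / 2) : ℝ)) (Metric.ball 0 1) := by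
    rw [integrableOn_fun_norm_addHaar volume (f := fun r : ℝ => r ^ (-(3 / 2) : ℝ))]
    simp only [finrank_euclideanSpace, Fintype.card_fin, Nat.add_one_sub_one, pow_one]
    have h1 : IntegrableOn (fun r : ℝ => r ^ (-(1 / 2) : ℝ)) (Set.Ioo 0 1) := by
      rw [← intervalIntegrable_iff_integrableOn_Ioo_of_le zero_le_one]
      exact intervalIntegral.intervalIntegrable_rpow' (by norm_num)
    refine h1.congr_fun (fun r hr => ?_) measurableSet_Ioo
    simp only [smul_eq_mul]
    rw [show (-(1 / 2) : ℝ) = 1 + -(3 / 2) by norm_num, Real.rpow_add hr.1, Real.rpow_one]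
  exact h.lintegral_lt_top

/-- This is the pointwise variance of a block, up to v. The terms decay like n^(-7/4) = n^(-5/8)
n^(-9/8): the first factor gives the gain in N and the second is summable. A gain better than
N^(-1/2) is what the tail estimate needs. -/
theorem exists_sum_sq_eigenProfile_le : ∃ C : ℝ, 0 < C ∧ ∀ N M r, 0 < r →
    ∑ n ∈ Finset.Ico N M, (eigenProfile n r / besselZero n) ^ 2 ≤
      C * (N + 1 : ℝ) ^ (-(5 / 8) : ℝ) * r ^ (-(3 / 4) : ℝ) := by
  obtain ⟨C, hC, h⟩ := exists_sq_eigenProfile_le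
  obtain ⟨δ, hδ, hz⟩ := exists_mul_le_besselZero
  have hs : Summable fun n : ℕ => ((n + 1 : ℕ) : ℝ) ^ (-(9 / 8) : ℝ) :=
    (summable_nat_add_iff 1).2 (Real.summable_nat_rpow.2 (by norm_num))
  set A := ∑' n : ℕ, ((n + 1 : ℕ) : ℝ) ^ (-(9 / 8) : ℝ)
  have hA : 0 ≤ A := tsum_nonneg fun n => by positivity
  refine ⟨C * δ ^ (-(7 / 4) : ℝ) * (A + 1), by positivity, fun N M r hr => ?_⟩
  set B := C * δ ^ (-(7 / 4) : ℝ) * (N + 1 : ℝ) ^ (-(5 / 8) : ℝ) * r ^ (-(3 / 4) : ℝ) with hB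
  have hB0 : 0 ≤ B := by positivity
  have hterm : ∀ n ∈ Finset.Ico N M, (eigenProfile n r / besselZero n) ^ 2 ≤
      B * ((n + 1 : ℕ) : ℝ) ^ (-(9 / 8) : ℝ) := by
    intro n hn
    have hzn := besselZero_pos n
    have hNn : N ≤ n := (Finset.mem_Ico.1 hn).1
    have h1 : besselZero n ^ (-(7 / 4) : ℝ) ≤
        δ ^ (-(7 / 4) : ℝ) * ((N + 1 : ℝ) ^ (-(5 / 8) : ℝ) *
          ((n + 1 : ℕ) : ℝ) ^ (-(9 / 8) : ℝ)) := by
      calc besselZero n ^ (-(7 / 4) : ℝ) ≤ (δ * (n + 1)) ^ (-(7 / 4) : ℝ) :=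
            Real.rpow_le_rpow_of_nonpos (by positivity) (hz n) (by norm_num)
        _ = δ ^ (-(7 / 4) : ℝ) * ((n + 1 : ℝ) ^ (-(5 / 8) : ℝ) * (n + 1 : ℝ) ^ (-(9 / 8) : ℝ)) := by
            rw [Real.mul_rpow hδ.le (by positivity), ← Real.rpow_add (by positivity)]
            norm_num
        _ ≤ _ := by
            push_cast
            gcongr ?_ * (?_ * ?_)
            exact Real.rpow_le_rpow_of_nonpos (by positivity)
              (by exact_mod_cast Nat.succ_le_succ hNn) (by norm_num)
    calc (eigenProfile n r / besselZero n) ^ 2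
        ≤ C * besselZero n ^ (1 / 4 : ℝ) * r ^ (-(3 / 4) : ℝ) / besselZero n ^ 2 := by
          rw [div_pow]
          gcongr
          exact h n r hr
      _ = C * besselZero n ^ (-(7 / 4) : ℝ) * r ^ (-(3 / 4) : ℝ) := by
          rw [show (-(7 / 4) : ℝ) = 1 / 4 - (2 : ℕ) by norm_num, Real.rpow_sub_natCast hzn.ne']
          ring
      _ ≤ C * (δ ^ (-(7 / 4) : ℝ) * ((N + 1 : ℝ) ^ (-(5 / 8) : ℝ) *
          ((n + 1 : ℕ) : ℝ) ^ (-(9 / 8) : ℝ))) * r ^ (-(3 / 4) : ℝ) := by gcongr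
      _ = _ := by
          rw [hB]
          ring
  calc ∑ n ∈ Finset.Ico N M, (eigenProfile n r / besselZero n) ^ 2
      ≤ ∑ n ∈ Finset.Ico N M, B * ((n + 1 : ℕ) : ℝ) ^ (-(9 / 8) : ℝ) := Finset.sum_le_sum hterm
    _ = B * ∑ n ∈ Finset.Ico N M, ((n + 1 : ℕ) : ℝ) ^ (-(9 / 8) : ℝ) := by rw [Finset.mul_sum]
    _ ≤ B * (A + 1) := by
        gcongr
        exact (hs.sum_le_tsum _ fun n _ => by positivity).trans (by linarith)
    _ = _ := by
        rw [hB]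
        ring

/-! ### Moments of the quartic norm of a tail -/

theorem pow_lintegral_le {α : Type*} [MeasurableSpace α] (ν : Measure α) {f : α → ℝ≥0∞}
    (hf : AEMeasurable f ν) {k : ℕ} (hk : 0 < k) :
    (∫⁻ x, f x ∂ν) ^ k ≤ ν Set.univ ^ (k - 1) * ∫⁻ x, f x ^ k ∂ν := by
  rcases Nat.eq_or_lt_of_le (Nat.succ_le_iff.2 hk) with rfl | hk1
  · simp
  have hpq : (k : ℝ).HolderConjugate (Real.conjExponent k) :=
    Real.HolderConjugate.conjExponent (by exact_mod_cast hk1)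
  have h := ENNReal.lintegral_mul_le_Lp_mul_Lq ν hpq hf (aemeasurable_const (b := (1 : ℝ≥0∞)))
  simp only [Pi.mul_apply, mul_one, ENNReal.one_rpow, lintegral_const, one_mul,
    ENNReal.rpow_natCast] at h
  have hk0 : (k : ℝ) ≠ 0 := by exact_mod_cast hk.ne'
  calc (∫⁻ x, f x ∂ν) ^ k
      ≤ ((∫⁻ x, f x ^ k ∂ν) ^ (1 / (k : ℝ)) * ν Set.univ ^ (1 / Real.conjExponent k)) ^ k := by
        gcongr
    _ = _ := by
        rw [mul_pow, ← ENNReal.rpow_natCast, ← ENNReal.rpow_natCast, ← ENNReal.rpow_mul,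
          ← ENNReal.rpow_mul, one_div_mul_cancel hk0, ENNReal.rpow_one, mul_comm,
          show 1 / Real.conjExponent k * k = ((k - 1 : ℕ) : ℝ) by
            rw [Nat.cast_sub hk, Real.conjExponent]
            field_simp
            simp, ENNReal.rpow_natCast]

/-- Jensen's inequality for the measure w dν applied to f/w. With w = |x|^(-3/2) the k-th moment of
f/w is bounded uniformly in x, whereas applying Jensen to f directly would require |x|^(-3k/2) to be
integrable. -/
theorem pow_lintegral_le_mul_lintegral_div {α : Type*} [MeasurableSpace α] (ν : Measure α)
    {f w : α → ℝ≥0∞} (hf : Measurable f) (hw : Measurable w) (hw0 : ∀ᵐ x ∂ν, w x ≠ 0)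
    (hw1 : ∀ᵐ x ∂ν, w x ≠ ∞) {k : ℕ} (hk : 0 < k) :
    (∫⁻ x, f x ∂ν) ^ k ≤
      (∫⁻ x, w x ∂ν) ^ (k - 1) * ∫⁻ x, w x * (f x ^ k / w x ^ k) ∂ν := by
  have h1 : ∫⁻ x, f x ∂ν = ∫⁻ x, f x / w x ∂ν.withDensity w := by
    refine Eq.trans ?_ (lintegral_withDensity_eq_lintegral_mul _ hw (hf.div hw)).symm
    refine lintegral_congr_ae ?_
    filter_upwards [hw0, hw1] with x h0 h1
    exact (ENNReal.mul_div_cancel h0 h1).symm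
  have h2 := pow_lintegral_le (ν.withDensity w) (hf.div hw).aemeasurable hk
  rw [withDensity_apply _ MeasurableSet.univ, Measure.restrict_univ,
    lintegral_withDensity_eq_lintegral_mul _ hw ((hf.div hw).pow_const k)] at h2
  rw [h1]
  refine h2.trans_eq ?_
  simp only [Pi.mul_apply, Pi.div_apply, div_eq_mul_inv, mul_pow, ENNReal.inv_pow]

/-- Apply the Gaussian moment of order 4k at each point: the variance enters squared, giving
N^(-5/4) and the weight |x|^(-3/2), and the moment constant gives k². The bound is uniform in M, so
it passes to the tail. -/
theorem exists_lintegral_blockFour_pow_le (v : ℝ≥0) : ∃ D : ℝ, 0 < D ∧ ∀ N M k : ℕ, 0 < k →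
    ∫⁻ g, blockFour N M g ^ k ∂gaussianSeq v ≤
      ENNReal.ofReal (4 * (D * k ^ 2 * (N + 1 : ℝ) ^ (-(5 / 4) : ℝ)) ^ k) := by
  obtain ⟨C, hC, hsum⟩ := exists_sum_sq_eigenProfile_le
  set w : Plane → ℝ≥0∞ := fun x => ENNReal.ofReal (‖x‖ ^ (-(3 / 2) : ℝ)) with hw
  have hwm : Measurable w := by fun_prop
  set A := ∫⁻ x in disc, w x with hA
  have hAfin : A ≠ ∞ := lintegral_norm_rpow_disc_lt_top.ne
  refine ⟨64 * Real.exp v ^ 2 * C ^ 2 * (A.toReal + 1), by positivity, fun N M k hk => ?_⟩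
  set R := C * (N + 1 : ℝ) ^ (-(5 / 8) : ℝ) with hR
  have hR0 : 0 < R := by positivity
  set B : ℝ := 4 * (4 * (2 * k : ℕ) * Real.exp v * R) ^ (2 * k) with hB
  have hB0 : 0 ≤ B := by positivity
  have hne : ∀ᵐ x ∂(volume.restrict disc : Measure Plane), x ≠ 0 :=
    ae_restrict_of_ae (Measure.ae_ne volume 0)
  have hwpos : ∀ x : Plane, x ≠ 0 → w x ≠ 0 := fun x hx => by
    have := norm_pos_iff.2 hx
    simp only [hw, ne_eq, ENNReal.ofReal_eq_zero, not_le]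
    positivity
  have hmom : ∀ x : Plane, x ≠ 0 →
      ∫⁻ g, (‖seriesBlock N M g x‖ₑ ^ 4) ^ k ∂gaussianSeq v ≤ ENNReal.ofReal B * w x ^ k := by
    intro x hx
    have hx' := norm_pos_iff.2 hx
    have h := lintegral_norm_sum_pow_gaussianSeq_le (v := v) (Finset.Ico N M)
      (fun n => eigenProfile n ‖x‖ / besselZero n) (ρ := R * ‖x‖ ^ (-(3 / 4) : ℝ)) (by positivity)
      (hsum N M ‖x‖ hx') (j := 2 * k) (by positivity)
    simp only [← pow_mul]
    rw [show 4 * k = 2 * (2 * k) by ring]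
    refine h.trans_eq ?_
    rw [hw, ← ENNReal.ofReal_pow (by positivity), ← ENNReal.ofReal_mul hB0]
    congr 1
    rw [← mul_assoc, mul_pow _ (‖x‖ ^ _), ← mul_assoc, pow_mul (‖x‖ ^ _),
      ← Real.rpow_natCast (‖x‖ ^ _) 2,
      ← Real.rpow_mul (norm_nonneg x)]
    norm_num [hB]
  have hmeas : Measurable fun p : (ℕ → ℂ) × Plane =>
      w p.2 * ((‖seriesBlock N M p.1 p.2‖ₑ ^ 4) ^ k / w p.2 ^ k) := by
    have := (measurable_seriesBlock N M).enorm
    have h2 : Measurable fun p : (ℕ → ℂ) × Plane => w p.2 := by fun_prop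
    exact h2.mul (((this.pow_const 4).pow_const k).div (h2.pow_const k))
  have hmeasg : ∀ x, Measurable fun g => (‖seriesBlock N M g x‖ₑ ^ 4) ^ k := fun x =>
    (((measurable_seriesBlock N M).comp measurable_prodMk_right).enorm.pow_const 4).pow_const k
  calc ∫⁻ g, blockFour N M g ^ k ∂gaussianSeq v
      ≤ ∫⁻ g, A ^ (k - 1) * (∫⁻ x in disc, w x * ((‖seriesBlock N M g x‖ₑ ^ 4) ^ k / w x ^ k))
          ∂gaussianSeq v := by
        refine lintegral_mono fun g => ?_
        refine pow_lintegral_le_mul_lintegral_div _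
          (((measurable_seriesBlock N M).comp measurable_prodMk_left).enorm.pow_const 4) hwm ?_
          (.of_forall fun x => ENNReal.ofReal_ne_top) hk
        filter_upwards [hne] with x hx using hwpos x hx
    _ = A ^ (k - 1) * ∫⁻ x in disc, w x *
          ((∫⁻ g, (‖seriesBlock N M g x‖ₑ ^ 4) ^ k ∂gaussianSeq v) / w x ^ k) := by
        rw [lintegral_const_mul _ (Measurable.lintegral_prod_right' hmeas),
          lintegral_lintegral_swap hmeas.aemeasurable]
        congr 1
        refine lintegral_congr_ae ?_
        filter_upwards with x
        simp only [div_eq_mul_inv]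
        rw [lintegral_const_mul _ ((hmeasg x).mul_const _), lintegral_mul_const _ (hmeasg x)]
    _ ≤ A ^ (k - 1) * ∫⁻ x in disc, w x * ENNReal.ofReal B := by
        refine mul_le_mul_right (lintegral_mono_ae ?_) _
        filter_upwards [hne] with x hx
        gcongr
        exact ENNReal.div_le_of_le_mul (hmom x hx)
    _ = A ^ k * ENNReal.ofReal B := by
        rw [lintegral_mul_const _ hwm, ← mul_assoc, ← hA, ← pow_succ, Nat.sub_add_cancel hk]
    _ ≤ ENNReal.ofReal ((A.toReal + 1) ^ k) * ENNReal.ofReal B := by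
        gcongr
        rw [ENNReal.ofReal_pow (by positivity)]
        gcongr
        rw [← ENNReal.ofReal_toReal hAfin]
        exact ENNReal.ofReal_le_ofReal (by simp)
    _ = _ := by
        rw [← ENNReal.ofReal_mul (by positivity)]
        congr 1
        rw [hB, pow_mul _ 2 k, mul_left_comm, ← mul_pow, hR, mul_pow _ _ 2, mul_pow C,
          ← Real.rpow_natCast (_ ^ _) 2, ← Real.rpow_mul (by positivity)]
        norm_num
        ring

/-- Fatou's lemma in M and Markov's inequality for the moment of order N, the cut-off itself: N²
N^(-5/4) divided by the threshold N leaves N^(-1/4) as the base. -/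
theorem exists_gaussianSeq_largeTail_le (v : ℝ≥0) : ∃ D : ℝ, 0 < D ∧ ∀ N : ℕ, 0 < N →
    gaussianSeq v (largeTail N) ≤ ENNReal.ofReal (4 * (D * (N : ℝ) ^ (-(1 / 4) : ℝ)) ^ N) := by
  obtain ⟨D, hD, h⟩ := exists_lintegral_blockFour_pow_le v
  refine ⟨D, hD, fun N hN => ?_⟩
  have hN' : (0 : ℝ) < N := by exact_mod_cast hN
  set b : ℝ := 4 * (D * N ^ 2 * (N + 1 : ℝ) ^ (-(5 / 4) : ℝ)) ^ N with hb
  have hfat : ∫⁻ g, liminf (fun M => blockFour N M g ^ N) atTop ∂gaussianSeq v ≤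
      ENNReal.ofReal b := by
    refine (lintegral_liminf_le fun M => (measurable_blockFour N M).pow_const N).trans ?_
    exact liminf_le_of_frequently_le' (Frequently.of_forall fun M => h N M N hN)
  have hsub : largeTail N ⊆
      {g | (N : ℝ≥0∞) ^ N ≤ liminf (fun M => blockFour N M g ^ N) atTop} := by
    intro g hg
    refine le_liminf_of_le ⟨∞, fun _ _ => le_top⟩ ?_
    have hg' : (N : ℝ≥0∞) < liminf (fun M => blockFour N M g) atTop := hg
    filter_upwards [eventually_lt_of_lt_liminf hg'] with M hM
    gcongr
  have hNN : (N : ℝ≥0∞) ^ N = ENNReal.ofReal ((N : ℝ) ^ N) := by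
    rw [ENNReal.ofReal_pow hN'.le, ENNReal.ofReal_natCast]
  have hmk := mul_meas_ge_le_lintegral (μ := gaussianSeq v)
    (Measurable.liminf fun M => (measurable_blockFour N M).pow_const N) ((N : ℝ≥0∞) ^ N)
  have hle : gaussianSeq v (largeTail N) ≤ ENNReal.ofReal b / ENNReal.ofReal ((N : ℝ) ^ N) := by
    rw [ENNReal.le_div_iff_mul_le (Or.inl (by simp))
      (Or.inl ENNReal.ofReal_ne_top), mul_comm, ← hNN]
    calc (N : ℝ≥0∞) ^ N * gaussianSeq v (largeTail N) ≤ _ := by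
          gcongr
      _ ≤ _ := hmk.trans hfat
  refine hle.trans ?_
  rw [← ENNReal.ofReal_div_of_pos (by positivity)]
  refine ENNReal.ofReal_le_ofReal ?_
  rw [hb, mul_div_assoc, ← div_pow]
  gcongr
  rw [div_le_iff₀ hN']
  calc D * N ^ 2 * (N + 1 : ℝ) ^ (-(5 / 4) : ℝ) ≤ D * N ^ 2 * (N : ℝ) ^ (-(5 / 4) : ℝ) := by
        gcongr ?_ * ?_
        exact Real.rpow_le_rpow_of_nonpos hN' (by linarith) (by norm_num)
    _ = _ := by
        rw [show (-(5 / 4) : ℝ) = -(1 / 4) - (1 : ℕ) by norm_num, Real.rpow_sub_natCast hN'.ne']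
        field_simp

theorem exists_pow_mul_rpow_le (D K : ℝ) (hD : 0 < D) : ∃ C : ℝ, 0 < C ∧ ∀ N : ℕ, 0 < N →
    (D * (N : ℝ) ^ (-(1 / 4) : ℝ)) ^ N ≤ C * Real.exp (-K * N) := by
  -- Multiplying the base by exp(K) still leaves it tending to 0; the finitely many N where it
  -- exceeds 1 go into the constant.
  set E := D * Real.exp K with hE
  have hE0 : 0 < E := by positivity
  have htend : Tendsto (fun N : ℕ => E * (N : ℝ) ^ (-(1 / 4) : ℝ)) atTop (𝓝 (E * 0)) :=
    ((tendsto_rpow_neg_atTop (by norm_num)).comp tendsto_natCast_atTop_atTop).const_mul E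
  rw [mul_zero] at htend
  obtain ⟨N₁, hN₁⟩ := eventually_atTop.1 (htend.eventually_lt_const one_pos)
  refine ⟨(max E 1) ^ N₁, by positivity, fun N hN => ?_⟩
  have hN' : (1 : ℝ) ≤ N := by exact_mod_cast hN
  have h1 : (D * (N : ℝ) ^ (-(1 / 4) : ℝ)) ^ N =
      (E * (N : ℝ) ^ (-(1 / 4) : ℝ)) ^ N * Real.exp (-K * N) := by
    rw [hE, mul_comm (-K), Real.exp_nat_mul, ← mul_pow, Real.exp_neg]
    congr 1
    field_simp
  rw [h1]
  gcongr
  rcases le_total N₁ N with h | h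
  · calc (E * (N : ℝ) ^ (-(1 / 4) : ℝ)) ^ N ≤ 1 := pow_le_one₀ (by positivity) (hN₁ N h).le
      _ ≤ _ := one_le_pow₀ (le_max_right _ _)
  · calc (E * (N : ℝ) ^ (-(1 / 4) : ℝ)) ^ N ≤ (max E 1) ^ N := by
          gcongr
          refine (mul_le_of_le_one_right hE0.le ?_).trans (le_max_left _ _)
          exact Real.rpow_le_one_of_one_le_of_nonpos hN' (by norm_num)
      _ ≤ _ := pow_le_pow_right₀ (le_max_right _ _) h

theorem exists_gaussianSeq_largeTail_le_exp (v : ℝ≥0) (K : ℝ) : ∃ C : ℝ, 0 < C ∧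
    ∀ N : ℕ, 0 < N → gaussianSeq v (largeTail N) ≤ ENNReal.ofReal (C * Real.exp (-K * N)) := by
  obtain ⟨D, hD, h⟩ := exists_gaussianSeq_largeTail_le v
  obtain ⟨C, hC, hC1⟩ := exists_pow_mul_rpow_le D K hD
  refine ⟨4 * C, by positivity, fun N hN => (h N hN).trans (ENNReal.ofReal_le_ofReal ?_)⟩
  rw [mul_assoc]
  gcongr
  exact hC1 N hN

/-! ### Splitting the weight -/

theorem coeFn_partialSeries (g : ℕ → ℂ) (M : ℕ) :
    ((partialSeries g M : Lp ℂ 2 discMeasure) : Plane → ℂ) =ᵐ[discMeasure]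
      fun x => ∑ n ∈ Finset.range M, g n / (besselZero n : ℂ) * eigenFun n x := by
  induction M with
  | zero =>
    simp only [partialSeries, Finset.range_zero, Finset.sum_empty, ZeroMemClass.coe_zero]
    exact Lp.coeFn_zero ℂ 2 discMeasure
  | succ M ih =>
    have h1 : (partialSeries g (M + 1) : Lp ℂ 2 discMeasure) =
        (partialSeries g M : Lp ℂ 2 discMeasure) +
          (g M / (besselZero M : ℂ)) • (eigenVec M : Lp ℂ 2 discMeasure) := by
      simp only [partialSeries, Finset.sum_range_succ, Submodule.coe_add, Submodule.coe_smul]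
    rw [h1]
    filter_upwards [Lp.coeFn_add (partialSeries g M : Lp ℂ 2 discMeasure)
      ((g M / (besselZero M : ℂ)) • (eigenVec M : Lp ℂ 2 discMeasure)),
      Lp.coeFn_smul (g M / (besselZero M : ℂ)) (eigenVec M : Lp ℂ 2 discMeasure),
      (memLp_eigenFun M).coeFn_toLp, ih] with x h2 h3 h4 h5
    rw [h2, Pi.add_apply, h3, Pi.smul_apply, h5, Finset.sum_range_succ, smul_eq_mul]
    congr 2

theorem projLE_randomSeries {g : ℕ → ℂ}
    (hg : Summable fun n => ‖g n / (besselZero n : ℂ)‖ ^ 2) (N : ℕ) (x : Plane) :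
    projLE N (randomSeries g) x =
      ∑ n ∈ Finset.range N, g n / (besselZero n : ℂ) * eigenFun n x := by
  simp only [projLE, inner_eigenVec_randomSeries hg]

theorem seriesBlock_eq_sub (g : ℕ → ℂ) {N M : ℕ} (h : N ≤ M) (x : Plane) :
    seriesBlock N M g x = ∑ n ∈ Finset.range M, g n / (besselZero n : ℂ) * eigenFun n x -
      ∑ n ∈ Finset.range N, g n / (besselZero n : ℂ) * eigenFun n x := by
  rw [← Finset.sum_Ico_eq_sub _ h, seriesBlock]
  refine Finset.sum_congr rfl fun n _ => ?_
  rw [eigenFun_eq]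
  push_cast
  ring

/-- The series converges only in L². Along a subsequence it converges almost everywhere, and Fatou's
lemma applies. For each c above the liminf, the subsequence is first chosen to have block norms
below c. -/
theorem lintegral_sub_projLE_le {g : ℕ → ℂ}
    (hg : Summable fun n => ‖g n / (besselZero n : ℂ)‖ ^ 2) (N : ℕ) :
    ∫⁻ x in disc, ‖(randomSeries g : Lp ℂ 2 discMeasure) x - projLE N (randomSeries g) x‖ₑ ^ 4 ≤
      tailFour N g := by
  refine le_of_forall_gt_imp_ge_of_dense fun c hc => ?_
  obtain ⟨φ, hφ, hφc⟩ := extraction_of_frequently_atTop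
    (frequently_lt_of_liminf_lt (by isBoundedDefault) hc)
  have hLp : Tendsto (fun k => (partialSeries g (φ k) : Lp ℂ 2 discMeasure)) atTop
      (𝓝 (randomSeries g : Lp ℂ 2 discMeasure)) :=
    (continuous_subtype_val.tendsto _).comp ((tendsto_partialSeries hg).comp hφ.tendsto_atTop)
  obtain ⟨ns, hns, hae⟩ := (tendstoInMeasure_of_tendsto_Lp hLp).exists_seq_tendsto_ae
  have hlim : ∀ᵐ x ∂discMeasure, Tendsto (fun k => ‖seriesBlock N (φ (ns k)) g x‖ₑ ^ 4) atTop
      (𝓝 (‖(randomSeries g : Lp ℂ 2 discMeasure) x - projLE N (randomSeries g) x‖ₑ ^ 4)) := by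
    filter_upwards [hae, ae_all_iff.2 (coeFn_partialSeries g)] with x h1 h2
    have h3 := ENNReal.Tendsto.pow (n := 4) (h1.sub_const (projLE N (randomSeries g) x)).enorm
    refine h3.congr' ?_
    filter_upwards [(hφ.tendsto_atTop.comp hns.tendsto_atTop).eventually_ge_atTop N] with k hk
    have hk : N ≤ φ (ns k) := hk
    rw [seriesBlock_eq_sub g hk, h2, projLE_randomSeries hg]
  calc ∫⁻ x in disc, ‖(randomSeries g : Lp ℂ 2 discMeasure) x - projLE N (randomSeries g) x‖ₑ ^ 4
      = ∫⁻ x in disc, liminf (fun k => ‖seriesBlock N (φ (ns k)) g x‖ₑ ^ 4) atTop := by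
        refine lintegral_congr_ae ?_
        filter_upwards [hlim] with x hx using hx.liminf_eq.symm
    _ ≤ liminf (fun k => blockFour N (φ (ns k)) g) atTop :=
        lintegral_liminf_le fun k =>
          (((measurable_seriesBlock N (φ (ns k))).comp measurable_prodMk_left).enorm.pow_const 4)
    _ ≤ c := liminf_le_of_frequently_le' (Frequently.of_forall fun k => (hφc (ns k)).le)

/-- Convexity of the fourth power at a/(1-t) and b/t with weights 1-t and t. The coefficient of a⁴
tends to 1 as t → 0, which preserves the gain 1-γ. -/
theorem add_pow_four_le {t a b : ℝ} (ht0 : 0 < t) (ht1 : t < 1) (ha : 0 ≤ a) (hb : 0 ≤ b) :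
    (a + b) ^ 4 ≤ ((1 - t) ^ 3)⁻¹ * a ^ 4 + (t ^ 3)⁻¹ * b ^ 4 := by
  have h1 : 0 < 1 - t := by linarith
  have h := (convexOn_pow 4).2 (x := a / (1 - t)) (y := b / t)
    (Set.mem_Ici.2 (by positivity)) (Set.mem_Ici.2 (by positivity)) h1.le ht0.le (by ring)
  simp only [smul_eq_mul] at h
  rw [mul_div_cancel₀ _ h1.ne', mul_div_cancel₀ _ ht0.ne'] at h
  refine h.trans_eq ?_
  field_simp

theorem enorm_pow_four_le {t : ℝ} (ht0 : 0 < t) (ht1 : t < 1) (u p : ℂ) :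
    ‖u‖ₑ ^ 4 ≤ ENNReal.ofReal ((1 - t) ^ 3)⁻¹ * ‖p‖ₑ ^ 4 +
      ENNReal.ofReal (t ^ 3)⁻¹ * ‖u - p‖ₑ ^ 4 := by
  have h1 : 0 < 1 - t := by linarith
  simp only [← ofReal_norm]
  rw [← ENNReal.ofReal_pow (norm_nonneg _), ← ENNReal.ofReal_pow (norm_nonneg _),
    ← ENNReal.ofReal_pow (norm_nonneg _), ← ENNReal.ofReal_mul (by positivity),
    ← ENNReal.ofReal_mul (by positivity), ← ENNReal.ofReal_add (by positivity) (by positivity)]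
  refine ENNReal.ofReal_le_ofReal ?_
  refine le_trans ?_ (add_pow_four_le ht0 ht1 (norm_nonneg p) (norm_nonneg (u - p)))
  gcongr
  simpa using norm_add_le p (u - p)

/-! ### The kinetic constraint and integrability of the weight -/

theorem continuous_inner_eigenVec (n : ℕ) :
    Continuous fun u : L2Rad => (inner ℂ (eigenVec n) u : ℂ) :=
  (innerSL ℂ (eigenVec n)).continuous

theorem continuous_projLE (N : ℕ) :
    Continuous fun p : L2Rad × Plane => projLE N p.1 p.2 := by
  unfold projLE
  refine continuous_finsetSum _ fun n _ => ?_
  exact ((continuous_inner_eigenVec n).comp continuous_fst).mul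
    ((continuous_eigenFun n).comp continuous_snd)

theorem continuous_projLE_apply (N : ℕ) (u : L2Rad) : Continuous (projLE N u) :=
  continuous_finsetSum _ fun n _ => continuous_const.mul (continuous_eigenFun n)

/-- A measurable set containing `awaySet`, on which the quartic norm of every dyadic projection is
controlled by its kinetic energy. -/
def kineticSet (γ : ℝ) : Set L2Rad :=
  {u | ∀ k : ℕ, ∫⁻ x in disc, ‖projLE (2 ^ k) u x‖ₑ ^ 4 ≤
    ENNReal.ofReal (2 * (1 - γ) *
      ∑ n ∈ Finset.range (2 ^ k), besselZero n ^ 2 * ‖inner ℂ (eigenVec n) u‖ ^ 2)}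

theorem measurableSet_kineticSet (γ : ℝ) : MeasurableSet (kineticSet γ) := by
  rw [kineticSet, Set.ofPred_forall]
  refine MeasurableSet.iInter fun k => measurableSet_le ?_ ?_
  · exact Measurable.lintegral_prod_right'
      (f := fun p : L2Rad × Plane => ‖projLE (2 ^ k) p.1 p.2‖ₑ ^ 4)
      ((continuous_projLE (2 ^ k)).measurable.enorm.pow_const 4)
  · refine Measurable.ennreal_ofReal (Continuous.measurable ?_)
    exact continuous_const.mul (continuous_finsetSum _ fun n _ =>
      continuous_const.mul ((continuous_inner_eigenVec n).norm.pow 2))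

theorem awaySet_subset_kineticSet (Q : Plane → ℝ) {γ γ' : ℝ} (h : γ' ≤ γ) :
    awaySet Q γ ⊆ kineticSet γ' := by
  intro u hu k
  have h1 := hu.2 k
  have hcont := continuous_projLE_apply (2 ^ k) u
  rw [setIntegral_gradSq_projLE] at h1
  have h2 : ∫⁻ x in disc, ‖projLE (2 ^ k) u x‖ₑ ^ 4 =
      ENNReal.ofReal (∫ x in disc, ‖projLE (2 ^ k) u x‖ ^ 4) := by
    rw [ofReal_integral_eq_lintegral_ofReal (integrable_disc_of_continuous (by fun_prop))
      (.of_forall fun x => by positivity)]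
    refine lintegral_congr fun x => ?_
    rw [ENNReal.ofReal_pow (norm_nonneg _), ofReal_norm]
  rw [h2]
  refine ENNReal.ofReal_le_ofReal ?_
  have h3 : 0 ≤ ∑ n ∈ Finset.range (2 ^ k), besselZero n ^ 2 * ‖inner ℂ (eigenVec n) u‖ ^ 2 :=
    Finset.sum_nonneg fun n _ => by positivity
  nlinarith [mul_le_mul_of_nonneg_right h h3]

theorem weight_le_ofReal_exp {u : L2Rad} {r : ℝ}
    (h : ∫⁻ x in disc, ‖(u : Lp ℂ 2 discMeasure) x‖ₑ ^ 4 ≤ ENNReal.ofReal (4 * r)) (hr : 0 ≤ r) :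
    weight u ≤ ENNReal.ofReal (Real.exp r) := by
  have h1 : (1 / 4 * ∫⁻ x in disc, ‖(u : Lp ℂ 2 discMeasure) x‖ₑ ^ 4 : ℝ≥0∞) ≤
      ENNReal.ofReal r := by
    calc (1 / 4 * ∫⁻ x in disc, ‖(u : Lp ℂ 2 discMeasure) x‖ₑ ^ 4 : ℝ≥0∞)
        ≤ 1 / 4 * ENNReal.ofReal (4 * r) := by gcongr
      _ = ENNReal.ofReal r := by
        rw [ENNReal.ofReal_mul (by norm_num), ENNReal.ofReal_ofNat, ← mul_assoc,
          ENNReal.div_mul_cancel (by norm_num) (by norm_num), one_mul]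
  rw [weight, ← EReal.exp_coe]
  refine EReal.exp_monotone ?_
  refine (EReal.coe_ennreal_le_coe_ennreal_iff.2 h1).trans_eq ?_
  rw [EReal.coe_ennreal_ofReal, max_eq_left hr]

theorem weight_randomSeries_le {g : ℕ → ℂ}
    (hg : Summable fun n => ‖g n / (besselZero n : ℂ)‖ ^ 2) {γ t : ℝ} (hγ : γ ≤ 1) (ht0 : 0 < t)
    (ht1 : t < 1) (hS : randomSeries g ∈ kineticSet γ) {k : ℕ} (hk : g ∉ largeTail (2 ^ k)) :
    weight (randomSeries g) ≤ ENNReal.ofReal (Real.exp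
      (((1 - t) ^ 3)⁻¹ * ((1 - γ) / 2) * ∑ n ∈ Finset.range (2 ^ k), ‖g n‖ ^ 2 +
        (t ^ 3)⁻¹ / 4 * (2 ^ k : ℕ))) := by
  have h1 : 0 < 1 - t := by linarith
  have hγ' : 0 ≤ 1 - γ := by linarith
  have h2 : 0 ≤ ∑ n ∈ Finset.range (2 ^ k), ‖g n‖ ^ 2 := Finset.sum_nonneg fun n _ => by positivity
  have hcont := continuous_projLE_apply (2 ^ k) (randomSeries g)
  refine weight_le_ofReal_exp ?_ (by positivity)
  have hkin := hS k
  have hsum : ∀ n, besselZero n ^ 2 * ‖inner ℂ (eigenVec n) (randomSeries g)‖ ^ 2 = ‖g n‖ ^ 2 := by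
    intro n
    rw [inner_eigenVec_randomSeries hg, norm_div, Complex.norm_real, Real.norm_eq_abs, div_pow,
      sq_abs, mul_div_cancel₀ _ (pow_ne_zero 2 (besselZero_pos n).ne')]
  simp only [hsum] at hkin
  have htail : ∫⁻ x in disc,
      ‖(randomSeries g : Lp ℂ 2 discMeasure) x - projLE (2 ^ k) (randomSeries g) x‖ₑ ^ 4 ≤
      ENNReal.ofReal (2 ^ k : ℕ) := by
    rw [ENNReal.ofReal_natCast]
    exact (lintegral_sub_projLE_le hg (2 ^ k)).trans (not_lt.1 hk)
  calc ∫⁻ x in disc, ‖(randomSeries g : Lp ℂ 2 discMeasure) x‖ₑ ^ 4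
      ≤ ∫⁻ x in disc, (ENNReal.ofReal ((1 - t) ^ 3)⁻¹ * ‖projLE (2 ^ k) (randomSeries g) x‖ₑ ^ 4 +
        ENNReal.ofReal (t ^ 3)⁻¹ * ‖(randomSeries g : Lp ℂ 2 discMeasure) x -
          projLE (2 ^ k) (randomSeries g) x‖ₑ ^ 4) :=
        lintegral_mono fun x => enorm_pow_four_le ht0 ht1 _ _
    _ = ENNReal.ofReal ((1 - t) ^ 3)⁻¹ * (∫⁻ x in disc, ‖projLE (2 ^ k) (randomSeries g) x‖ₑ ^ 4) +
        ENNReal.ofReal (t ^ 3)⁻¹ * ∫⁻ x in disc, ‖(randomSeries g : Lp ℂ 2 discMeasure) x -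
          projLE (2 ^ k) (randomSeries g) x‖ₑ ^ 4 := by
        rw [lintegral_add_left ((hcont.measurable.enorm.pow_const 4).const_mul _),
          lintegral_const_mul _ (hcont.measurable.enorm.pow_const 4),
          lintegral_const_mul' _ _ ENNReal.ofReal_ne_top]
    _ ≤ ENNReal.ofReal ((1 - t) ^ 3)⁻¹ *
          ENNReal.ofReal (2 * (1 - γ) * ∑ n ∈ Finset.range (2 ^ k), ‖g n‖ ^ 2) +
        ENNReal.ofReal (t ^ 3)⁻¹ * ENNReal.ofReal (2 ^ k : ℕ) := by
        gcongr
    _ = _ := by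
        rw [← ENNReal.ofReal_mul (by positivity), ← ENNReal.ofReal_mul (by positivity),
          ← ENNReal.ofReal_add (by positivity) (by positivity)]
        congr 1
        ring

/-- Let S be the sum of the |g_n|². Where S ≤ LN the integrand is at most exponential in N and the
rarity of a large tail wins. Where S ≥ LN, raising θ to a θ' still below 1/(2v) gains
exp(-(θ'-θ)LN), which beats the moment D^(2N) for large L. The sum runs up to 2N because the first
good cut-off is twice the last bad one. -/
theorem exists_lintegral_largeTail_le {v : ℝ≥0} (hv : v ≠ 0) {θ : ℝ} (hθ0 : 0 ≤ θ)
    (hθ : θ < 1 / (2 * v)) (c : ℝ) : ∃ C : ℝ, 0 < C ∧ ∀ N : ℕ, 0 < N →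
    ∫⁻ g in largeTail N, ENNReal.ofReal (Real.exp
      (θ * ∑ n ∈ Finset.range (2 * N), ‖g n‖ ^ 2 + c * (2 * N : ℕ))) ∂gaussianSeq v ≤
      ENNReal.ofReal (C * Real.exp (-(N : ℝ))) := by
  obtain ⟨θ', h1, h2⟩ := exists_between hθ
  set D := ∫⁻ z, ENNReal.ofReal (Real.exp (θ' * ‖z‖ ^ 2)) ∂complexGaussian v with hD
  have hDfin : D < ∞ := lintegral_exp_normSq_complexGaussian_lt_top hv h2
  set d := D.toReal with hd
  have hd0 : 0 ≤ d := ENNReal.toReal_nonneg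
  have hDd : D ≤ ENNReal.ofReal (Real.exp d) := by
    rw [← ENNReal.ofReal_toReal hDfin.ne]
    exact ENNReal.ofReal_le_ofReal (by linarith [Real.add_one_le_exp d])
  -- L makes the total exponent of the second term exactly -N; the rate θL + 2c + 1 requested next
  -- does the same for the first.
  set L := (2 * d + 2 * c + 1) / (θ' - θ) with hL
  obtain ⟨C, hC, hC1⟩ := exists_gaussianSeq_largeTail_le_exp v (θ * L + 2 * c + 1)
  refine ⟨C + 1, by positivity, fun N hN => ?_⟩
  have hs : 0 < θ' - θ := by linarith
  have hpt : ∀ g : ℕ → ℂ, ENNReal.ofReal (Real.exp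
      (θ * ∑ n ∈ Finset.range (2 * N), ‖g n‖ ^ 2 + c * (2 * N : ℕ))) ≤
      ENNReal.ofReal (Real.exp ((θ * L + 2 * c) * N)) +
      ENNReal.ofReal (Real.exp (2 * c * N - (θ' - θ) * L * N)) *
        ENNReal.ofReal (Real.exp (θ' * ∑ n ∈ Finset.range (2 * N), ‖g n‖ ^ 2)) := by
    intro g
    set S := ∑ n ∈ Finset.range (2 * N), ‖g n‖ ^ 2
    rw [← ENNReal.ofReal_mul (Real.exp_pos _).le, ← Real.exp_add]
    push_cast
    rcases le_total S (L * N) with h | h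
    · refine le_add_right (ENNReal.ofReal_le_ofReal (Real.exp_le_exp.2 ?_))
      nlinarith [mul_le_mul_of_nonneg_left h hθ0]
    · refine le_add_left (ENNReal.ofReal_le_ofReal (Real.exp_le_exp.2 ?_))
      nlinarith [mul_le_mul_of_nonneg_left h hs.le]
  calc ∫⁻ g in largeTail N, ENNReal.ofReal (Real.exp
      (θ * ∑ n ∈ Finset.range (2 * N), ‖g n‖ ^ 2 + c * (2 * N : ℕ))) ∂gaussianSeq v
      ≤ ∫⁻ g in largeTail N, (ENNReal.ofReal (Real.exp ((θ * L + 2 * c) * N)) +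
      ENNReal.ofReal (Real.exp (2 * c * N - (θ' - θ) * L * N)) *
        ENNReal.ofReal (Real.exp (θ' * ∑ n ∈ Finset.range (2 * N), ‖g n‖ ^ 2))) ∂gaussianSeq v :=
        lintegral_mono hpt
    _ ≤ ENNReal.ofReal (Real.exp ((θ * L + 2 * c) * N)) * gaussianSeq v (largeTail N) +
      ENNReal.ofReal (Real.exp (2 * c * N - (θ' - θ) * L * N)) * D ^ (2 * N) := by
        rw [lintegral_add_left measurable_const, setLIntegral_const,
          lintegral_const_mul _ (by fun_prop), hD, ← lintegral_exp_sum_normSq_gaussianSeq]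
        gcongr
        exact Measure.restrict_le_self
    _ ≤ ENNReal.ofReal (Real.exp ((θ * L + 2 * c) * N)) *
          ENNReal.ofReal (C * Real.exp (-(θ * L + 2 * c + 1) * N)) +
      ENNReal.ofReal (Real.exp (2 * c * N - (θ' - θ) * L * N)) *
        ENNReal.ofReal (Real.exp d) ^ (2 * N) := by
        gcongr
        exact hC1 N hN
    _ = _ := by
        rw [← ENNReal.ofReal_pow (Real.exp_pos _).le, ← ENNReal.ofReal_mul (Real.exp_pos _).le,
          ← ENNReal.ofReal_mul (Real.exp_pos _).le,
          ← ENNReal.ofReal_add (by positivity) (by positivity), ← Real.exp_nat_mul, mul_left_comm,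
          ← Real.exp_add, ← Real.exp_add]
        have e1 : (θ * L + 2 * c) * N + -(θ * L + 2 * c + 1) * N = -N := by ring
        have e2 : 2 * c * N - (θ' - θ) * L * N + (2 * N : ℕ) * d = -N := by
          rw [hL, mul_div_cancel₀ _ hs.ne']
          push_cast
          ring
        rw [e1, e2]
        congr 1
        ring

theorem lintegral_kineticSet_lt_top {v : ℝ≥0} (hv : v ≠ 0) (hv1 : v ≤ 1) {γ : ℝ} (hγ0 : 0 < γ)
    (hγ1 : γ ≤ 1) : ∫⁻ u in kineticSet γ, weight u ∂freeGaussian v < ∞ := by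
  -- Then (1-t)³ ≥ 1 - 3γ/4 > 1-γ, so θ below stays strictly under 1/2.
  set t : ℝ := γ / 4 with ht
  have ht0 : 0 < t := by positivity
  have ht1 : t < 1 := by linarith
  have ht3 : 0 < (1 - t) ^ 3 := pow_pos (by linarith) 3
  set θ := ((1 - t) ^ 3)⁻¹ * ((1 - γ) / 2) with hθ
  have hθ0 : 0 ≤ θ := mul_nonneg (by positivity) (by linarith)
  have hvpos : (0 : ℝ) < v := NNReal.coe_pos.2 (pos_iff_ne_zero.2 hv)
  have hθ1 : θ < 1 / (2 * v) := by
    have h1 : θ < 1 / 2 := by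
      rw [hθ, ← div_eq_inv_mul, div_lt_iff₀ ht3, ht]
      nlinarith [sq_nonneg γ, pow_pos hγ0 3]
    refine h1.trans_le (one_div_le_one_div_of_le (by positivity) ?_)
    have : (v : ℝ) ≤ 1 := by exact_mod_cast hv1
    linarith
  set c := (t ^ 3)⁻¹ / 4 with hc
  obtain ⟨C, hC, hC1⟩ := exists_lintegral_largeTail_le hv hθ0 hθ1 c
  set F : ℕ → (ℕ → ℂ) → ℝ≥0∞ := fun k g => ENNReal.ofReal (Real.exp
    (θ * ∑ n ∈ Finset.range (2 ^ k), ‖g n‖ ^ 2 + c * (2 ^ k : ℕ))) with hF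
  have hFm : ∀ k, Measurable (F k) := fun k => by fun_prop
  -- The probabilities of large tails tend to 0, so almost surely some dyadic tail is small and a
  -- first good index exists.
  have hgood : ∀ᵐ g ∂gaussianSeq v, ∃ k, g ∉ largeTail (2 ^ k) := by
    obtain ⟨C', hC', h'⟩ := exists_gaussianSeq_largeTail_le_exp v 1
    have htend : Tendsto (fun k : ℕ => ENNReal.ofReal (C' * Real.exp (-1 * ((2 ^ k : ℕ) : ℝ))))
        atTop (𝓝 (ENNReal.ofReal (C' * 0))) := by
      refine ENNReal.tendsto_ofReal (Tendsto.const_mul C' ?_)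
      simp only [neg_one_mul]
      exact (Real.tendsto_exp_neg_atTop_nhds_zero).comp (tendsto_natCast_atTop_atTop.comp
        (tendsto_pow_atTop_atTop_of_one_lt one_lt_two))
    rw [mul_zero, ENNReal.ofReal_zero] at htend
    rw [ae_iff]
    refine le_antisymm (ge_of_tendsto' htend fun k => ?_) zero_le
    refine (measure_mono fun g hg => ?_).trans (h' (2 ^ k) (by positivity))
    simp only [not_exists, not_not] at hg
    exact hg k
  have hae : ∀ᵐ g ∂gaussianSeq v, (kineticSet γ).indicator weight (randomSeries g) ≤
      F 0 g + ∑' k, (largeTail (2 ^ k)).indicator (F (k + 1)) g := by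
    filter_upwards [hgood, ae_summable_normSq_gaussianSeq hv] with g hk hg
    by_cases hS : randomSeries g ∈ kineticSet γ
    swap
    · rw [Set.indicator_of_notMem hS]
      exact zero_le
    rw [Set.indicator_of_mem hS]
    classical
    have hle := weight_randomSeries_le hg hγ1 ht0 ht1 hS (Nat.find_spec hk)
    rcases hfind : Nat.find hk with _ | k
    · rw [hfind] at hle
      exact le_add_right hle
    · rw [hfind] at hle
      -- Minimality of k + 1 puts g in the bad event at the preceding scale.
      have hmem : g ∈ largeTail (2 ^ k) := not_not.1 (Nat.find_min hk (by omega))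
      refine le_add_left (hle.trans ?_)
      refine le_trans ?_ (ENNReal.le_tsum k)
      rw [Set.indicator_of_mem hmem]
  have hF0 : ∫⁻ g, F 0 g ∂gaussianSeq v < ∞ := by
    have h1 : ∀ g : ℕ → ℂ, F 0 g = ENNReal.ofReal (Real.exp c) *
        ENNReal.ofReal (Real.exp (θ * ∑ n ∈ Finset.range 1, ‖g n‖ ^ 2)) := by
      intro g
      rw [← ENNReal.ofReal_mul (Real.exp_pos _).le, ← Real.exp_add, hF]
      simp [add_comm]
    simp only [h1]
    rw [lintegral_const_mul _ (by fun_prop), lintegral_exp_sum_normSq_gaussianSeq, pow_one]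
    exact ENNReal.mul_lt_top ENNReal.ofReal_lt_top
      (lintegral_exp_normSq_complexGaussian_lt_top hv hθ1)
  have hFk : ∀ k, ∫⁻ g, (largeTail (2 ^ k)).indicator (F (k + 1)) g ∂gaussianSeq v ≤
      ENNReal.ofReal (C * Real.exp (-(k : ℝ))) := by
    intro k
    rw [lintegral_indicator (measurableSet_largeTail _)]
    have h1 := hC1 (2 ^ k) (by positivity)
    rw [← pow_succ'] at h1
    refine h1.trans (ENNReal.ofReal_le_ofReal ?_)
    gcongr
    exact k.lt_two_pow_self.le
  have hsum : Summable fun k : ℕ => C * Real.exp (-(k : ℝ)) :=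
    Real.summable_exp_neg_nat.mul_left C
  calc ∫⁻ u in kineticSet γ, weight u ∂freeGaussian v
      = ∫⁻ u, (kineticSet γ).indicator weight u ∂freeGaussian v :=
        (lintegral_indicator (measurableSet_kineticSet γ) _).symm
    -- For a pushforward measure this inequality holds without measurability of the integrand, so
    -- none is required of the weight.
    _ ≤ ∫⁻ g, (kineticSet γ).indicator weight (randomSeries g) ∂gaussianSeq v :=
        lintegral_map_le _ _
    _ ≤ ∫⁻ g, (F 0 g + ∑' k, (largeTail (2 ^ k)).indicator (F (k + 1)) g) ∂gaussianSeq v :=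
        lintegral_mono_ae hae
    _ = ∫⁻ g, F 0 g ∂gaussianSeq v +
        ∑' k, ∫⁻ g, (largeTail (2 ^ k)).indicator (F (k + 1)) g ∂gaussianSeq v := by
        rw [lintegral_add_left (hFm 0), lintegral_tsum fun k =>
          ((hFm (k + 1)).indicator (measurableSet_largeTail _)).aemeasurable]
    _ ≤ ∫⁻ g, F 0 g ∂gaussianSeq v + ∑' k : ℕ, ENNReal.ofReal (C * Real.exp (-(k : ℝ))) := by
        gcongr with k
        exact hFk k
    _ < ∞ := ENNReal.add_lt_top.2 ⟨hF0, hsum.tsum_ofReal_lt_top⟩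

end DiscGibbs

end

theorem proposition3p2 (Q : DiscGibbs.Plane → ℝ) (hQ : DiscGibbs.IsGroundState Q)
    (v : ℝ≥0) (hv : v = 1 / 2 ∨ v = 1) (γ : ℝ) (hγ : 0 < γ) :
    ∫⁻ u in DiscGibbs.awaySet Q γ, DiscGibbs.weight u ∂(DiscGibbs.freeGaussian v) < ∞ := by
  have hv0 : v ≠ 0 := by rcases hv with rfl | rfl <;> norm_num
  have hv1 : v ≤ 1 := by
    rcases hv with rfl | rfl
    · rw [← NNReal.coe_le_coe]
      norm_num
    · exact le_rfl
  -- Replacing γ by min γ 1 weakens the constraint and ensures 1-γ ≥ 0.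
  exact (lintegral_mono_set (DiscGibbs.awaySet_subset_kineticSet Q (min_le_left γ 1))).trans_lt
    (DiscGibbs.lintegral_kineticSet_lt_top hv0 hv1 (lt_min hγ one_pos) (min_le_right γ 1))
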